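/- **Theorem 1.2.** Let $N\ge 2$ and let $\chi_N$ be a primitive Dirichlet character modulo $N$. For $\operatorname{Im} y>0$ put $q=e^{2\pi i y}$, $\zeta_N=e^{2\pi i/N}$ and $$\mathfrak f(y)=\sum_{k=1}^{N}\chi_N(k)\,\log(\zeta_N^k;q)_\infty,\qquad \log(x;q)_\infty:=\sum_{n\ge 0}\log(1-xq^n)\ \text{(principal logarithms)},$$ where the term $k=N$ is omitted since $\chi_N(N)=0$. Then $\mathfrak f$ has a unique asymptotic expansion $\tilde{\mathfrak f}(y)=\sum_{n\ge n_0}c_n y^n$ (a formal Laurent series) as $y\to 0$ with $\operatorname{Im}y>0$, uniformly in every sector $\operatorname{Im} y\ge \varepsilon|y|$, $\varepsilon>0$; and $\tilde{\mathfrak f}$ is a modular resurgent series if and only if $\chi_N$ is odd, that is, $\chi_N(-1)=-1$. Here the Borel transform of a formal Laurent series $\sum_n c_n y^n$ is $\mathcal B(\zeta)=\sum_{n\ge 0}\frac{c_{n+1}}{n!}\zeta^n$ (terms of degree $\le 0$ are disregarded), and the series is called *modular resurgent* if 1. it is Gevrey-1: $|c_{n+1}|\le C r^{-n}n!$ for all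 $n\ge0$, for some $C,r>0$; 2. there are $\mathcal A\in\mathbb C\setminus\{0\}$ and non-zero numbers $S_m\in\mathbb C$ ($m\in\mathbb Z_{\ne0}$), the Stokes constants, such that $\mathcal B$ continues analytically to $\mathbb C\setminus\{m\mathcal A: m\in\mathbb Z_{\neq 0}\}$ with a simple pole at each $m\mathcal A$, where $\mathcal B(\zeta)=-\frac{S_m}{2\pi i(\zeta-m\mathcal A)}+(\text{regular})$; 3. $L_+(s)=\sum_{m>0}S_m m^{-s}$ and $L_-(s)=-\sum_{m>0}S_{-m}m^{-s}$ are $L$-functions, where $\sum_{m>0} a_m m^{-s}$ is called an $L$-function if $a_1\neq0$, it converges absolutely in some half-plane $\operatorname{Re}s>\sigma\ge0$ and equals there $a_1\prod_p\sum_{k\ge0}\frac{a_{p^k}}{a_1}p^{-ks}$, and it continues meromorphically to $\mathbb C$. If $\chi_N$ is odd, then these conditions hold with $\mathcal A=2\pi i/N$ and Stokes constants $$R_m=2\sum_{d\mid m}\frac dm\,\chi_N(d),\qquad m\in\mathbb Z_{\neq0},$$ the sum being over the positive divisors $d$ of $m$; that is, the Borel singularities are simple poles, located at the points $2\pi i m/N$.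 Moreover, in that case, $$\sum_{m>0}\frac{R_m}{m^s}=2L(s,\chi_N)\zeta(s+1)\qquad(\operatorname{Re}s>1),$$ and with $\Lambda(s,\chi)=N^{s/2}\pi^{-(s+1)/2}\Gamma\!\big(\tfrac{s+1}2\big)L(s,\chi)$ (for $\chi$ odd modulo $N$), $\Lambda_\zeta(s)=\pi^{-s/2}\Gamma(\tfrac s2)\zeta(s)$ and $\mathscr G(\chi_N)=\sum_{j=1}^{N-1}\chi_N(j)e^{2\pi i j/N}$, the functional equation $$\Lambda(s+1,\overline{\chi_N})\,\Lambda_\zeta(s)=\frac{i\sqrt N}{\mathscr G(\chi_N)}\,\Lambda(-s,\chi_N)\,\Lambda_\zeta(1-s)$$ holds for all $s\in\mathbb C\setminus\{0,1\}$; its right-hand side is the completion of $L(\cdot,\chi_N)\,\zeta(\cdot+1)$ evaluated at $-s$. -/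

import Mathlib

open Filter Topology Asymptotics

noncomputable section

/-- `f_{k,N}(y) = log (ζ_N^k; q)_∞` with `ζ_N = e^{2πi/N}` and `q = e^{2πiy}`, where the logarithm of
the infinite product `∏_{n ≥ 0} (1 - ζ_N^k q^n)` is the sum of the principal logarithms of its
factors. This is the branch that is holomorphic in `y` on the upper half-plane. -/
def logQPochhammer (N k : ℕ) (y : ℂ) : ℂ :=
  ∑' n : ℕ, Complex.log
    (1 - Complex.exp (2 * Real.pi * Complex.I * k / N) *
      Complex.exp (2 * Real.pi * Complex.I * y) ^ n)

/-- `𝔣(y) = ∑_{k = 1}^{N} χ(k) f_{k,N}(y)`. -/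
def weightedSum {N : ℕ} (χ : DirichletCharacter ℂ N) (y : ℂ) : ℂ :=
  ∑ k ∈ Finset.Icc 1 N, χ (k : ZMod N) * logQPochhammer N k y

/-- The sector `{y | Im y > 0, Im y ≥ ε |y|}`, closed in the punctured plane. For `0 < ε < 1` these
sectors exhaust the upper half-plane. -/
def upperSector (ε : ℝ) : Set ℂ := {y | 0 < y.im ∧ ε * ‖y‖ ≤ y.im}

/-- The formal Laurent series `φ` is the (Poincaré) asymptotic expansion of `f` as `y → 0` with
`Im y > 0`, uniformly in proper closed subsectors of the upper half-plane. -/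
def HasAsymptoticExpansion (f : ℂ → ℂ) (φ : LaurentSeries ℂ) : Prop :=
  ∀ ε : ℝ, 0 < ε → ∀ K : ℤ,
    (fun y : ℂ => f y - ∑ n ∈ Finset.Ico φ.order K, φ.coeff n * y ^ n)
      =O[𝓝[upperSector ε] 0] fun y : ℂ => y ^ K

/-- The Gevrey-1 bound for `∑_{n ≥ 0} a_n y^{n+1}`, the part of positive degree of `φ`:
`|a_n| ≤ C r^{-n} n!` with `a_n = φ.coeff (n + 1)`. -/
def IsGevreyOne (φ : LaurentSeries ℂ) : Prop :=
  ∃ C r : ℝ, 0 < C ∧ 0 < r ∧ ∀ n : ℕ, ‖φ.coeff (n + 1)‖ ≤ C * r⁻¹ ^ n * n.factorial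

/-- `B` coincides near `0` with the (convergent) Borel transform `∑_{n ≥ 0} (a_n / n!) ζ^n` of the
part of positive degree `∑_{n ≥ 0} a_n y^{n+1}` of `φ`. -/
def IsBorelTransformNearZero (φ : LaurentSeries ℂ) (B : ℂ → ℂ) : Prop :=
  ∀ᶠ ζ in 𝓝 (0 : ℂ),
    HasSum (fun n : ℕ => φ.coeff (n + 1) / (n.factorial : ℂ) * ζ ^ n) (B ζ)

/-- The Borel transform of `φ` continues analytically to the complement of the points `m A`, `m` a
non-zero integer, and has at each of them a singularity with constant resurgent series `S m`, that
is, a simple pole with local expansion `- S_m / (2πi (ζ - m A)) + (regular)` and `S_m ≠ 0`. -/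
structure HasSimplePoleTower (φ : LaurentSeries ℂ) (A : ℂ) (S : ℤ → ℂ) : Prop where
  location_ne_zero : A ≠ 0
  stokes_ne_zero : ∀ m : ℤ, m ≠ 0 → S m ≠ 0
  continuation : ∃ B : ℂ → ℂ, IsBorelTransformNearZero φ B ∧
    (∀ ζ : ℂ, (∀ m : ℤ, m ≠ 0 → ζ ≠ m * A) → AnalyticAt ℂ B ζ) ∧
    ∀ m : ℤ, m ≠ 0 → ∃ h : ℂ → ℂ, AnalyticAt ℂ h (m * A) ∧
      ∀ᶠ ζ in 𝓝[≠] ((m : ℂ) * A),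
        B ζ = -(S m / (2 * Real.pi * Complex.I * (ζ - m * A))) + h ζ

/-- The Dirichlet series `∑_{m > 0} a_m m^{-s}` converges (absolutely) in some right half-plane
`Re s > σ ≥ 0`, where it has, up to its leading coefficient `a_1 ≠ 0`, an Euler product
`∏_p ∑_{k ≥ 0} (a_{p^k} / a_1) p^{-ks}`, and it continues meromorphically to `ℂ`. -/
def DefinesLFunction (a : ℕ → ℂ) : Prop :=
  a 1 ≠ 0 ∧ ∃ σ : ℝ, 0 ≤ σ ∧ ∃ L : ℂ → ℂ, MeromorphicOn L Set.univ ∧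
    ∀ s : ℂ, σ < s.re →
      LSeriesHasSum a s (L s) ∧
      HasProd (fun p : Nat.Primes =>
        ∑' k : ℕ, a ((p : ℕ) ^ k) / a 1 * ((p : ℕ) : ℂ) ^ (-((k : ℂ) * s))) (L s / a 1)

/-- `φ` is a modular resurgent series whose Borel singularities are at `m A` with Stokes constants
`S m`, for `m` a non-zero integer. -/
structure IsModularResurgentWith (φ : LaurentSeries ℂ) (A : ℂ) (S : ℤ → ℂ) : Prop where
  gevrey : IsGevreyOne φ
  tower : HasSimplePoleTower φ A S
  lfunction_pos : DefinesLFunction fun m : ℕ => S m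
  lfunction_neg : DefinesLFunction fun m : ℕ => -S (-(m : ℤ))

/-- `φ` is a modular resurgent series. -/
def IsModularResurgent (φ : LaurentSeries ℂ) : Prop :=
  ∃ (A : ℂ) (S : ℤ → ℂ), IsModularResurgentWith φ A S

/-- `R_m = 2 ∑_{d ∣ m} (d / m) χ(d)`, the sum being over the positive divisors of `m`. -/
def stokesConstant {N : ℕ} (χ : DirichletCharacter ℂ N) (m : ℤ) : ℂ :=
  2 * ∑ d ∈ m.natAbs.divisors, (d : ℂ) / (m : ℂ) * χ (d : ZMod N)

/-- `Λ(s, χ) = N^{s/2} π^{-(s+δ)/2} Γ((s+δ)/2) L(s, χ)`, where `χ(-1) = (-1)^δ`; Mathlib's completed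
`L`-function lacks the factor `N^{s/2}`. -/
def completedDirichletL {N : ℕ} [NeZero N] (χ : DirichletCharacter ℂ N) (s : ℂ) : ℂ :=
  (N : ℂ) ^ (s / 2) * DirichletCharacter.completedLFunction χ s

end

/-! Put `t = -2πi y`, so that `q = e^{-t}` and the upper half-plane becomes `Re t > 0`. Then the
weighted sum is `∑_{n ≥ 0} g(n t)` with `g = weightedLog χ` (`weightedSum_eq_tsum`). Since `χ(0) =
0`, the function `g` is holomorphic at `0`; it also decays exponentially in sectors. Euler–Maclaurin
summation therefore gives the expansion (`norm_tsum_weightedLog_sub_le`): a term in `1/t` from the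
dilogarithm primitive of `g`, and coefficients `-B_{j+1}/(j+1)! · g^{(j)}(0)` of `t^j`.

Everything then rests on a parity. The derivative `D = g'` satisfies `D(-w) = -χ(-1) D(w)`
(`weightedLogDeriv_neg`), while the coefficient of `y^{n+1}` contains `B_{n+2} D^{(n)}(0)`. If `χ`
is even, then `D` is odd and one factor always vanishes: the Borel transform is zero, and by the
identity theorem it cannot acquire poles (`not_hasSimplePoleTower_of_coeff_eq_zero`).

If `χ` is odd, only even `n` survive, and Euler's formula turns `B_{n+2}` into `ζ(n+2)`. Writing
`ζ(n+2) = ∑_e e^{-n-2}` and exchanging sums, the Borel transform becomes `(i/π) ∑_e D(ξ/e)/e²`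
(`eventually_hasSum_borelSum`). This series is meromorphic on the whole plane. As `D` has residue
`χ(n)` at `2πi n/N`, the residues at `2πi m/N` add up to a divisor sum, which is the Stokes constant
(`hasSimplePoleAt_borelSum`).

Up to the factor `2`, the Stokes constants with positive index are the Dirichlet convolution of `χ`
with `n ↦ 1/n`. Multiplicativity yields their nonvanishing and the Euler product, and the Dirichlet
series factors as `2 L(s, χ) ζ(s+1)` (`definesLFunction_stokesConstant`). -/

noncomputable section

/-! ### Arithmetic of the Stokes constants and their Dirichlet series -/

/-- A Dirichlet character as an arithmetic function. -/
def characterArith {N : ℕ} (χ : DirichletCharacter ℂ N) : ArithmeticFunction ℂ :=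
  ⟨fun n => if n = 0 then 0 else χ (n : ZMod N), by simp⟩

/-- The arithmetic function `n ↦ 1 / n`. -/
def invArith : ArithmeticFunction ℂ :=
  ⟨fun n => (n : ℂ)⁻¹, by simp⟩

lemma characterArith_apply {N : ℕ} (χ : DirichletCharacter ℂ N) {n : ℕ} (hn : n ≠ 0) :
    characterArith χ n = χ (n : ZMod N) := by
  simp [characterArith, hn]

lemma invArith_apply (n : ℕ) : invArith n = (n : ℂ)⁻¹ := rfl

lemma isMultiplicative_characterArith {N : ℕ} (χ : DirichletCharacter ℂ N) :
    (characterArith χ).IsMultiplicative := by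
  rw [ArithmeticFunction.IsMultiplicative.iff_ne_zero]
  refine ⟨by simp [characterArith_apply], fun {m n} hm hn _ => ?_⟩
  rw [characterArith_apply χ hm, characterArith_apply χ hn,
    characterArith_apply χ (mul_ne_zero hm hn)]
  simp

lemma isMultiplicative_invArith : invArith.IsMultiplicative := by
  rw [ArithmeticFunction.IsMultiplicative.iff_ne_zero]
  refine ⟨by simp [invArith_apply], fun {m n} hm hn _ => ?_⟩
  simp [invArith_apply, mul_comm]

lemma isMultiplicative_characterArith_mul_invArith {N : ℕ} (χ : DirichletCharacter ℂ N) :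
    (characterArith χ * invArith).IsMultiplicative :=
  (isMultiplicative_characterArith χ).mul isMultiplicative_invArith

lemma characterArith_mul_invArith_apply {N : ℕ} (χ : DirichletCharacter ℂ N) (m : ℕ) :
    (characterArith χ * invArith) m =
      ∑ d ∈ m.divisors, (d : ℂ) / (m : ℂ) * χ (d : ZMod N) := by
  rw [ArithmeticFunction.mul_apply,
    Nat.sum_divisorsAntidiagonal (fun d e => characterArith χ d * invArith e)]
  refine Finset.sum_congr rfl fun d hd => ?_
  have hdm := Nat.dvd_of_mem_divisors hd
  have hd0 : d ≠ 0 := (Nat.pos_of_mem_divisors hd).ne'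
  rw [characterArith_apply χ hd0, invArith_apply, Nat.cast_div hdm (by exact_mod_cast hd0),
    inv_div, mul_comm]

lemma stokesConstant_natCast {N : ℕ} (χ : DirichletCharacter ℂ N) (m : ℕ) :
    stokesConstant χ (m : ℤ) = 2 * (characterArith χ * invArith) m := by
  rw [characterArith_mul_invArith_apply, stokesConstant]
  simp

lemma stokesConstant_neg {N : ℕ} (χ : DirichletCharacter ℂ N) (m : ℤ) :
    stokesConstant χ (-m) = -stokesConstant χ m := by
  simp [stokesConstant, div_neg, Finset.sum_neg_distrib]

lemma norm_natCast_mul_character_ne_one {N : ℕ} (χ : DirichletCharacter ℂ N) {p : ℕ}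
    (hp : p.Prime) : ‖(p : ℂ) * χ (p : ZMod N)‖ ≠ 1 := by
  by_cases h : IsUnit (p : ZMod N)
  · obtain ⟨u, hu⟩ := h
    rw [norm_mul, ← hu, DirichletCharacter.unit_norm_eq_one, mul_one, Complex.norm_natCast]
    exact_mod_cast hp.ne_one
  · rw [χ.map_nonunit h]
    simp

/-- By multiplicativity it suffices to treat prime powers. There the value is `p^{-k} ∑_{i ≤ k} x^i`
with `x = p χ(p)`; its vanishing would make `x` a root of unity, but `|x|` is `p` or `0`. -/
lemma characterArith_mul_invArith_ne_zero {N : ℕ} (χ : DirichletCharacter ℂ N) {m : ℕ}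
    (hm : m ≠ 0) : (characterArith χ * invArith) m ≠ 0 := by
  rw [(isMultiplicative_characterArith_mul_invArith χ).multiplicative_factorization _ hm,
    Finsupp.prod, Finset.prod_ne_zero_iff]
  intro p hp
  have hp' : p.Prime := Nat.prime_of_mem_primeFactors hp
  generalize m.factorization p = k
  have hp0 : (p : ℂ) ≠ 0 := by exact_mod_cast hp'.ne_zero
  rw [characterArith_mul_invArith_apply, Nat.divisors_prime_pow hp', Finset.sum_map]
  set x : ℂ := (p : ℂ) * χ (p : ZMod N) with hx
  have hsum : ∑ i ∈ Finset.range (k + 1), (((⟨(p ^ ·), Nat.pow_right_injective hp'.two_le⟩ :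
      ℕ ↪ ℕ) i : ℕ) : ℂ) / ((p ^ k : ℕ) : ℂ) *
        χ (((⟨(p ^ ·), Nat.pow_right_injective hp'.two_le⟩ : ℕ ↪ ℕ) i : ℕ) : ZMod N) =
      ((p : ℂ) ^ k)⁻¹ * ∑ i ∈ Finset.range (k + 1), x ^ i := by
    rw [Finset.mul_sum]
    refine Finset.sum_congr rfl fun i _ => ?_
    simp only [Function.Embedding.coeFn_mk, Nat.cast_pow, map_pow, hx, mul_pow]
    ring
  rw [hsum]
  refine mul_ne_zero (inv_ne_zero (pow_ne_zero _ hp0)) fun h0 => ?_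
  have h1 := mul_geom_sum x (k + 1)
  rw [h0, mul_zero] at h1
  have h2 : x ^ (k + 1) = 1 := (sub_eq_zero.mp h1.symm)
  exact norm_natCast_mul_character_ne_one χ hp' (Complex.norm_eq_one_of_pow_eq_one h2 (by omega))

lemma stokesConstant_ne_zero {N : ℕ} (χ : DirichletCharacter ℂ N) {m : ℤ} (hm : m ≠ 0) :
    stokesConstant χ m ≠ 0 := by
  have key : ∀ n : ℕ, n ≠ 0 → stokesConstant χ (n : ℤ) ≠ 0 := fun n hn => by
    rw [stokesConstant_natCast]
    exact mul_ne_zero two_ne_zero (characterArith_mul_invArith_ne_zero χ hn)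
  obtain ⟨n, rfl | rfl⟩ := m.eq_nat_or_neg
  · exact key n (by simpa using hm)
  · rw [stokesConstant_neg]
    exact neg_ne_zero.mpr (key n (by simpa using hm))

lemma lseriesHasSum_characterArith {N : ℕ} [NeZero N] (χ : DirichletCharacter ℂ N) {s : ℂ}
    (hs : 1 < s.re) : LSeriesHasSum (characterArith χ) s (χ.LFunction s) := by
  rw [DirichletCharacter.LFunction_eq_LSeries χ hs]
  exact (LSeriesHasSum_congr s _ fun {n} hn => characterArith_apply χ hn).mpr
    (DirichletCharacter.LSeriesSummable_of_one_lt_re χ hs).LSeriesHasSum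

lemma lseriesHasSum_invArith {s : ℂ} (hs : 0 < s.re) :
    LSeriesHasSum invArith s (riemannZeta (s + 1)) := by
  have h1 : 1 < (s + 1).re := by simpa using hs
  have h := LSeriesHasSum_one h1
  unfold LSeriesHasSum at h ⊢
  convert h using 1
  ext n
  rcases eq_or_ne n 0 with rfl | hn
  · simp
  · have hn' : (n : ℂ) ≠ 0 := by exact_mod_cast hn
    rw [LSeries.term_of_ne_zero hn, LSeries.term_of_ne_zero hn, invArith_apply,
      Complex.cpow_add _ _ hn', Complex.cpow_one]
    simp only [Pi.one_apply]
    field_simp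

lemma lseriesHasSum_stokesConstant {N : ℕ} [NeZero N] (χ : DirichletCharacter ℂ N) {s : ℂ}
    (hs : 1 < s.re) :
    LSeriesHasSum (fun m : ℕ => stokesConstant χ m) s
      (2 * (χ.LFunction s * riemannZeta (s + 1))) := by
  have h := ((ArithmeticFunction.LSeriesHasSum_mul (lseriesHasSum_characterArith χ hs)
    (lseriesHasSum_invArith (by linarith))).smul 2)
  convert h using 1
  ext m
  simp [stokesConstant_natCast]

lemma meromorphicOn_LFunction_mul_riemannZeta {N : ℕ} [NeZero N] {χ : DirichletCharacter ℂ N}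
    (hχ : χ ≠ 1) :
    MeromorphicOn (fun s => 2 * (χ.LFunction s * riemannZeta (s + 1))) Set.univ := by
  have hL : Meromorphic (fun s => χ.LFunction s) := fun s =>
    ((DirichletCharacter.differentiable_LFunction hχ).analyticAt s).meromorphicAt
  have hz : Meromorphic (fun s : ℂ => riemannZeta (s + 1)) := fun s => by
    by_cases hs : s = 0
    -- At the pole, `ζ(s+1)` is written as the completed zeta function, with its two polar terms
    -- split off, times the entire function `1/Γ_ℝ`.
    · subst hs
      have h1 : MeromorphicAt (fun s : ℂ => (completedRiemannZeta₀ (s + 1) - 1 / (s + 1) -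
          1 / (1 - (s + 1))) * (Complex.Gammaℝ (s + 1))⁻¹) 0 := by
        have hid : MeromorphicAt (fun s : ℂ => s + 1) 0 := by fun_prop
        have h0 : MeromorphicAt (fun s : ℂ => completedRiemannZeta₀ (s + 1)) 0 :=
          ((differentiable_completedZeta₀.comp
            (differentiable_id.add_const (1 : ℂ))).analyticAt 0).meromorphicAt
        have h2 : MeromorphicAt (fun s : ℂ => (Complex.Gammaℝ (s + 1))⁻¹) 0 :=
          ((Complex.differentiable_Gammaℝ_inv.comp
            (differentiable_id.add_const (1 : ℂ))).analyticAt 0).meromorphicAt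
        exact ((h0.sub ((MeromorphicAt.const 1 0).div hid)).sub ((MeromorphicAt.const 1 0).div
          ((MeromorphicAt.const 1 0).sub hid))).mul h2
      refine h1.congr (Filter.Eventually.filter_mono nhdsWithin_le_nhds ?_)
      filter_upwards [isOpen_ne.mem_nhds (show (0 : ℂ) ≠ -1 by norm_num)] with z hz
      rw [riemannZeta_def_of_ne_zero (fun h => hz (eq_neg_of_add_eq_zero_left h)),
        completedRiemannZeta_eq]
      exact (div_eq_mul_inv _ _).symm
    · have : AnalyticAt ℂ (fun s : ℂ => riemannZeta (s + 1)) s := by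
        rw [Complex.analyticAt_iff_eventually_differentiableAt]
        filter_upwards [isOpen_ne.mem_nhds hs] with z hz
        exact (differentiableAt_riemannZeta (by simpa using hz)).comp z
          (differentiableAt_id.add_const 1)
      exact this.meromorphicAt
  intro s _
  exact (MeromorphicAt.const 2 s).mul ((hL s).mul (hz s))

lemma definesLFunction_stokesConstant {N : ℕ} [NeZero N] {χ : DirichletCharacter ℂ N}
    (hχ : χ ≠ 1) : DefinesLFunction fun m : ℕ => stokesConstant χ m := by
  refine ⟨stokesConstant_ne_zero χ one_ne_zero, 1, zero_le_one, _,
    meromorphicOn_LFunction_mul_riemannZeta hχ, fun s hs => ⟨lseriesHasSum_stokesConstant χ hs, ?_⟩⟩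
  have hmul := isMultiplicative_characterArith_mul_invArith χ
  set F := characterArith χ * invArith
  have hF1 : F 1 = 1 := hmul.map_one
  have hLS := lseriesHasSum_stokesConstant χ hs
  have hterm : ∀ n : ℕ, LSeries.term (fun m : ℕ => stokesConstant χ m) s n =
      2 * LSeries.term F s n := fun n => by
    rcases eq_or_ne n 0 with rfl | hn
    · simp
    · rw [LSeries.term_of_ne_zero hn, LSeries.term_of_ne_zero hn, stokesConstant_natCast]
      ring
  -- The Stokes constants are `2 F`, so the Euler product is taken for the normalised function `F`,
  -- with `F 1 = 1`.
  have hFS : HasSum (LSeries.term F s) (χ.LFunction s * riemannZeta (s + 1)) := by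
    have := HasSum.mul_left (2 : ℂ)⁻¹ hLS
    simpa [hterm] using this
  have hprod := EulerProduct.eulerProduct_hasProd (f := LSeries.term F s)
    (by simp [LSeries.term_of_ne_zero, hF1])
    (fun {m n} hmn => by
      rcases eq_or_ne m 0 with rfl | hm
      · simp
      rcases eq_or_ne n 0 with rfl | hn
      · simp
      rw [LSeries.term_of_ne_zero hm, LSeries.term_of_ne_zero hn,
        LSeries.term_of_ne_zero (mul_ne_zero hm hn), hmul.map_mul_of_coprime hmn, Nat.cast_mul,
        Complex.natCast_mul_natCast_cpow]
      field_simp) hFS.summable.norm (LSeries.term_zero _ _)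
  rw [hFS.tsum_eq] at hprod
  convert hprod using 1
  · ext p
    refine tsum_congr fun k => ?_
    have hp : (p : ℕ) ≠ 0 := p.prop.ne_zero
    have h2 : (2 : ℂ) * F ((p : ℕ) ^ k) / (2 * F 1) = F ((p : ℕ) ^ k) := by
      rw [hF1]
      ring
    refine Eq.trans ?_ (LSeries.term_of_ne_zero (pow_ne_zero k hp) F s).symm
    dsimp only
    rw [stokesConstant_natCast, stokesConstant_natCast, h2, Complex.cpow_neg, Nat.cast_pow,
      Complex.natCast_cpow_natCast_mul, div_eq_mul_inv]
  · dsimp only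
    rw [stokesConstant_natCast, hF1]
    ring

/-! ### Primitive characters and the functional equation -/

lemma ne_one_of_isPrimitive {N : ℕ} [NeZero N] (hN : 2 ≤ N) {χ : DirichletCharacter ℂ N}
    (hχ : χ.IsPrimitive) : χ ≠ 1 := by
  rintro rfl
  rw [DirichletCharacter.IsPrimitive, DirichletCharacter.conductor_one] at hχ
  omega

/-- A vanishing Gauss sum would make the root number zero, and the functional equation would then
give `L(2, χ) = 0`, against nonvanishing on `Re s ≥ 1`. -/
lemma gaussSum_stdAddChar_ne_zero {N : ℕ} [NeZero N] {χ : DirichletCharacter ℂ N}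
    (hχ : χ.IsPrimitive) : gaussSum χ ZMod.stdAddChar ≠ 0 := by
  intro h
  have h1 := hχ.completedLFunction_one_sub (-1)
  rw [DirichletCharacter.rootNumber, h] at h1
  have h2 := DirichletCharacter.LFunction_eq_completed_div_gammaFactor χ 2 (Or.inl two_ne_zero)
  rw [show (2 : ℂ) = 1 - -1 by ring, h1] at h2
  simp only [zero_div, mul_zero, zero_mul] at h2
  exact DirichletCharacter.LFunction_ne_zero_of_one_le_re χ (s := 1 - -1)
    (Or.inr (by norm_num)) (by norm_num) h2

lemma completedDirichletL_functional_equation {N : ℕ} [NeZero N] {χ : DirichletCharacter ℂ N}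
    (hχ : χ.IsPrimitive) (hodd : χ.Odd) (s : ℂ) :
    completedDirichletL χ⁻¹ (s + 1) * completedRiemannZeta s =
      Complex.I * (Real.sqrt N : ℂ) / gaussSum χ ZMod.stdAddChar *
        (completedDirichletL χ (-s) * completedRiemannZeta (-s + 1)) := by
  have hG := gaussSum_stdAddChar_ne_zero hχ
  have hN0 : (N : ℂ) ≠ 0 := NeZero.ne _
  have hneven : ¬ χ.Even := hodd.not_even
  have hsqrt : (Real.sqrt N : ℂ) = (N : ℂ) ^ (1 / 2 : ℂ) := by
    rw [Real.sqrt_eq_rpow, Complex.ofReal_cpow (Nat.cast_nonneg _)]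
    simp
  have hfe := hχ.completedLFunction_one_sub (s + 1)
  rw [show 1 - (s + 1) = -s by ring] at hfe
  have hz : completedRiemannZeta (-s + 1) = completedRiemannZeta s := by
    rw [← completedRiemannZeta_one_sub s]
    ring_nf
  rw [completedDirichletL, completedDirichletL, hz, hfe, DirichletCharacter.rootNumber,
    if_neg hneven, pow_one, hsqrt]
  -- The normalising powers of `N` on the two sides absorb the conductor factor `N^{s+1/2}` of the
  -- functional equation.
  have hpow : (N : ℂ) ^ ((s + 1) / 2) = (N : ℂ) ^ (-s / 2) * (N : ℂ) ^ (s + 1 - 1 / 2) := by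
    rw [← Complex.cpow_add _ _ hN0]
    ring_nf
  have hh : (N : ℂ) ^ (1 / 2 : ℂ) ≠ 0 := by
    rw [Ne, Complex.cpow_eq_zero_iff]
    simp [hN0]
  rw [hpow]
  field_simp [Complex.I_ne_zero]

end

/-! ### Euler–Maclaurin summation in a sector -/

noncomputable section

/-- The closed sector `ε |w| ≤ Re w` around the positive real axis, with its vertex. -/
def rightSector (ε : ℝ) : Set ℂ := {w | ε * ‖w‖ ≤ w.re}

lemma zero_mem_rightSector (ε : ℝ) : (0 : ℂ) ∈ rightSector ε := by simp [rightSector]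

lemma re_nonneg_of_mem_rightSector {ε : ℝ} (hε : 0 < ε) {w : ℂ} (hw : w ∈ rightSector ε) :
    0 ≤ w.re :=
  (mul_nonneg hε.le (norm_nonneg w)).trans hw

lemma re_pos_of_mem_rightSector {ε : ℝ} (hε : 0 < ε) {w : ℂ} (hw : w ∈ rightSector ε)
    (h0 : w ≠ 0) : 0 < w.re :=
  (mul_pos hε (norm_pos_iff.mpr h0)).trans_le hw

lemma ofReal_mul_mem_rightSector {ε : ℝ} {w : ℂ} (hw : w ∈ rightSector ε) {x : ℝ} (hx : 0 ≤ x) :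
    (x : ℂ) * w ∈ rightSector ε := by
  have h : ε * ‖w‖ ≤ w.re := hw
  simp only [rightSector, Set.mem_ofPred_eq, norm_mul, Complex.norm_real, Real.norm_eq_abs,
    abs_of_nonneg hx, Complex.re_ofReal_mul]
  nlinarith [mul_le_mul_of_nonneg_left h hx]

lemma natCast_add_mul_mem_rightSector {ε : ℝ} {t : ℂ} (ht : t ∈ rightSector ε) (n : ℕ) {x : ℝ}
    (hx : 0 ≤ x) : ((n : ℂ) + x) * t ∈ rightSector ε := by
  have := ofReal_mul_mem_rightSector ht (x := n + x) (by positivity)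
  simpa using this

/-- The Euler–Maclaurin remainder of order `p` over the interval `[n, n + 1]`, for the function
`x ↦ f (x t)` whose `p`-th derivative is `t ^ p * g (x t)`. -/
def bernoulliIntegral (p : ℕ) (g : ℂ → ℂ) (t : ℂ) (n : ℕ) : ℂ :=
  ∫ x in (0 : ℝ)..1, ((bernoulliFun p x / p.factorial : ℝ) : ℂ) * g ((n + x) * t)

section EulerMaclaurin

variable {ε : ℝ} {g : ℕ → ℂ → ℂ}

lemma norm_bernoulliIntegral_le (hε : 0 < ε) {p : ℕ} {f : ℂ → ℂ} {C : ℝ}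
    (hb : ∀ w ∈ rightSector ε, ‖f w‖ ≤ C * Real.exp (-w.re)) :
    ∃ M : ℝ, 0 ≤ M ∧ ∀ t ∈ rightSector ε, ∀ n : ℕ,
      ‖bernoulliIntegral p f t n‖ ≤ M * Real.exp (-t.re) ^ n := by
  obtain ⟨K, hK⟩ := isCompact_Icc.exists_bound_of_continuousOn
    (s := Set.Icc (0 : ℝ) 1) (f := fun x => bernoulliFun p x / p.factorial)
    ((continuous_bernoulliFun p).div_const _).continuousOn
  have hK0 : 0 ≤ K := (norm_nonneg _).trans (hK 0 (by simp))
  have hC0 : 0 ≤ C := by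
    have := (norm_nonneg _).trans (hb 0 (zero_mem_rightSector ε))
    simpa using this
  refine ⟨K * C, mul_nonneg hK0 hC0, fun t ht n => ?_⟩
  have h := intervalIntegral.norm_integral_le_of_norm_le_const (a := (0 : ℝ)) (b := 1)
    (f := fun x : ℝ => ((bernoulliFun p x / p.factorial : ℝ) : ℂ) * f ((n + x) * t))
    (C := K * C * Real.exp (-t.re) ^ n) (fun x hx => ?_)
  · simpa [bernoulliIntegral] using h
  · rw [Set.uIoc_of_le zero_le_one] at hx
    have hx0 : 0 ≤ x := hx.1.le
    rw [norm_mul, Complex.norm_real, mul_assoc]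
    refine mul_le_mul (hK x ⟨hx0, hx.2⟩) ?_ (norm_nonneg _) hK0
    refine (hb _ (natCast_add_mul_mem_rightSector ht n hx0)).trans ?_
    refine mul_le_mul_of_nonneg_left ?_ hC0
    rw [← Real.exp_nat_mul, Real.exp_le_exp]
    have ht0 := re_nonneg_of_mem_rightSector hε ht
    have hre : (((n : ℂ) + x) * t).re = (n + x) * t.re := by
      simp [Complex.mul_re]
    rw [hre]
    nlinarith

lemma inv_one_sub_exp_neg_le {x : ℝ} (hx : 0 < x) : (1 - Real.exp (-x))⁻¹ ≤ 1 + 1 / x := by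
  have h1 : Real.exp (-x) ≤ 1 / (1 + x) := by
    rw [Real.exp_neg, ← one_div]
    exact one_div_le_one_div_of_le (by linarith) (by linarith [Real.add_one_le_exp x])
  have h2 : x / (1 + x) ≤ 1 - Real.exp (-x) := by
    have : x / (1 + x) = 1 - 1 / (1 + x) := by
      field_simp
      ring
    linarith
  calc (1 - Real.exp (-x))⁻¹ ≤ (x / (1 + x))⁻¹ := inv_anti₀ (by positivity) h2
    _ = 1 + 1 / x := by
      field_simp
      ring

lemma exp_neg_re_lt_one (hε : 0 < ε) {t : ℂ} (ht : t ∈ rightSector ε) (h0 : t ≠ 0) :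
    Real.exp (-t.re) < 1 := by
  rw [Real.exp_lt_one_iff]
  linarith [re_pos_of_mem_rightSector hε ht h0]

lemma summable_of_norm_le_exp_pow (hε : 0 < ε) {t : ℂ} (ht : t ∈ rightSector ε) (h0 : t ≠ 0)
    {u : ℕ → ℂ} {M : ℝ} (hu : ∀ n, ‖u n‖ ≤ M * Real.exp (-t.re) ^ n) : Summable u :=
  Summable.of_norm_bounded ((summable_geometric_of_lt_one (Real.exp_nonneg _)
    (exp_neg_re_lt_one hε ht h0)).mul_left M) hu

/-- The integrals are dominated by a geometric series of ratio `e^{-Re t}`, whose sum is at most a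
multiple of `1 + 1/Re t`; in the sector `Re t ≥ ε|t|`. -/
lemma norm_tsum_bernoulliIntegral_le (hε : 0 < ε) (p : ℕ) {f : ℂ → ℂ} {C : ℝ}
    (hb : ∀ w ∈ rightSector ε, ‖f w‖ ≤ C * Real.exp (-w.re)) :
    ∃ M : ℝ, ∀ t ∈ rightSector ε, t ≠ 0 → ‖t‖ ≤ 1 →
      ‖∑' n, bernoulliIntegral p f t n‖ ≤ M / ‖t‖ := by
  obtain ⟨M, hM0, hM⟩ := norm_bernoulliIntegral_le hε (p := p) hb
  refine ⟨M * (1 + 1 / ε), fun t ht h0 h1 => ?_⟩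
  have hlt := exp_neg_re_lt_one hε ht h0
  have hgeo := (hasSum_geometric_of_lt_one (Real.exp_nonneg _) hlt).mul_left M
  have htn : 0 < ‖t‖ := norm_pos_iff.mpr h0
  have hre : ε * ‖t‖ ≤ t.re := ht
  calc ‖∑' n, bernoulliIntegral p f t n‖ ≤ M * (1 - Real.exp (-t.re))⁻¹ :=
        tsum_of_norm_bounded hgeo (hM t ht)
    _ ≤ M * (1 + 1 / t.re) := by
        gcongr
        exact inv_one_sub_exp_neg_le (re_pos_of_mem_rightSector hε ht h0)
    _ ≤ M * (1 / ‖t‖ + 1 / (ε * ‖t‖)) := by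
        gcongr
        rwa [le_div_iff₀ htn, one_mul]
    _ = M * (1 + 1 / ε) / ‖t‖ := by
        field_simp

lemma summable_comp_natCast_mul (hε : 0 < ε) {f : ℂ → ℂ} {C : ℝ}
    (hb : ∀ w ∈ rightSector ε, ‖f w‖ ≤ C * Real.exp (-w.re)) {t : ℂ} (ht : t ∈ rightSector ε)
    (h0 : t ≠ 0) : Summable fun n : ℕ => f (n * t) := by
  refine summable_of_norm_le_exp_pow hε ht h0 (M := C) fun n => ?_
  have h := hb _ (ofReal_mul_mem_rightSector ht (x := n) (Nat.cast_nonneg n))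
  rw [← Real.exp_nat_mul]
  simpa using h

/-- Integration by parts, since `B_{p+1}(x)/(p+1)!` is a primitive of `B_p(x)/p!`. -/
lemma bernoulliIntegral_succ (hd : ∀ p, ∀ w ∈ rightSector ε, HasDerivAt (g p) (g (p + 1) w) w)
    (p : ℕ) {t : ℂ} (ht : t ∈ rightSector ε) (n : ℕ) :
    bernoulliIntegral p (g p) t n =
      ((bernoulliFun (p + 1) 1 / (p + 1).factorial : ℝ) : ℂ) * g p ((n + 1 : ℕ) * t) -
        ((bernoulliFun (p + 1) 0 / (p + 1).factorial : ℝ) : ℂ) * g p (n * t) -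
        t * bernoulliIntegral (p + 1) (g (p + 1)) t n := by
  have hu : ∀ x ∈ Set.uIcc (0 : ℝ) 1,
      HasDerivAt (fun x : ℝ => ((bernoulliFun (p + 1) x / (p + 1).factorial : ℝ) : ℂ))
        ((bernoulliFun p x / p.factorial : ℝ) : ℂ) x := fun x _ => by
    refine HasDerivAt.ofReal_comp ?_
    have h := (hasDerivAt_bernoulliFun (p + 1) x).div_const ((p + 1).factorial : ℝ)
    have e : ((p + 1 : ℕ) : ℝ) * bernoulliFun (p + 1 - 1) x / (p + 1).factorial =
        bernoulliFun p x / p.factorial := ?_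
    · exact e ▸ h
    rw [Nat.factorial_succ, Nat.add_sub_cancel]
    push_cast
    field_simp
  have hv : ∀ x ∈ Set.uIcc (0 : ℝ) 1,
      HasDerivAt (fun x : ℝ => g p (((n : ℂ) + x) * t)) (g (p + 1) ((n + x) * t) * t) x :=
    fun x hx => by
      rw [Set.uIcc_of_le zero_le_one] at hx
      have h1 : HasDerivAt (fun x : ℝ => ((n : ℂ) + x) * t) t x := by
        simpa using (((hasDerivAt_id x).ofReal_comp).const_add (n : ℂ)).mul_const t
      exact (hd p _ (natCast_add_mul_mem_rightSector ht n hx.1)).comp x h1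
  have hcont : ContinuousOn (fun x : ℝ => g (p + 1) (((n : ℂ) + x) * t)) (Set.uIcc (0 : ℝ) 1) := by
    intro x hx
    rw [Set.uIcc_of_le zero_le_one] at hx
    refine ContinuousAt.continuousWithinAt ?_
    exact ContinuousAt.comp (f := fun x : ℝ => ((n : ℂ) + x) * t)
      (hd (p + 1) _ (natCast_add_mul_mem_rightSector ht n hx.1)).continuousAt (by fun_prop)
  have h := intervalIntegral.integral_mul_deriv_eq_deriv_mul hu hv
    (Continuous.intervalIntegrable (Complex.continuous_ofReal.comp
      ((continuous_bernoulliFun p).div_const _)) 0 1)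
    ((hcont.mul continuousOn_const).intervalIntegrable)
  have h2 : t * bernoulliIntegral (p + 1) (g (p + 1)) t n =
      ∫ x in (0 : ℝ)..1, ((bernoulliFun (p + 1) x / (p + 1).factorial : ℝ) : ℂ) *
        (g (p + 1) ((n + x) * t) * t) := by
    rw [bernoulliIntegral, ← intervalIntegral.integral_const_mul]
    refine intervalIntegral.integral_congr fun x _ => ?_
    ring
  rw [h2, h, Complex.ofReal_one, Complex.ofReal_zero, add_zero, Nat.cast_succ]
  exact (sub_sub_self _ _).symm

/-- Summed over `n`, the boundary terms telescope because `B_{p+1}(1) = B_{p+1}(0)` for `p > 0`. For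
`p = 0` the jump `B_1(1) - B_1(0) = 1` leaves the full sum of `g 0`. -/
lemma tsum_bernoulliIntegral_succ (hε : 0 < ε)
    (hd : ∀ p, ∀ w ∈ rightSector ε, HasDerivAt (g p) (g (p + 1) w) w)
    (hb : ∀ p, ∃ C, ∀ w ∈ rightSector ε, ‖g p w‖ ≤ C * Real.exp (-w.re))
    (p : ℕ) {t : ℂ} (ht : t ∈ rightSector ε) (h0 : t ≠ 0) :
    ∑' n, bernoulliIntegral p (g p) t n =
      (if p = 0 then ∑' n : ℕ, g 0 (n * t) else 0) -
        ((bernoulliFun (p + 1) 1 / (p + 1).factorial : ℝ) : ℂ) * g p 0 -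
        t * ∑' n, bernoulliIntegral (p + 1) (g (p + 1)) t n := by
  obtain ⟨C, hC⟩ := hb p
  obtain ⟨C', hC'⟩ := hb (p + 1)
  obtain ⟨M', -, hM'⟩ := norm_bernoulliIntegral_le hε (p := p + 1) hC'
  have hs0 : Summable fun n : ℕ => g p (n * t) := summable_comp_natCast_mul hε hC ht h0
  have hs1 : Summable fun n : ℕ => g p ((n + 1 : ℕ) * t) :=
    (summable_nat_add_iff 1 (f := fun n : ℕ => g p (n * t))).mpr hs0
  have hs2 : Summable fun n => bernoulliIntegral (p + 1) (g (p + 1)) t n :=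
    summable_of_norm_le_exp_pow hε ht h0 (hM' t ht)
  have hsplit : ∑' n : ℕ, g p (n * t) = g p 0 + ∑' n : ℕ, g p ((n + 1 : ℕ) * t) := by
    rw [hs0.tsum_eq_zero_add]
    simp
  rw [tsum_congr (bernoulliIntegral_succ hd p ht),
    ((hs1.mul_left _).sub (hs0.mul_left _)).tsum_sub (hs2.mul_left _),
    (hs1.mul_left _).tsum_sub (hs0.mul_left _), tsum_mul_left, tsum_mul_left, tsum_mul_left]
  rcases eq_or_ne p 0 with rfl | hp
  · have hs : ∑' n : ℕ, g 0 ((n + 1 : ℕ) * t) = ∑' n : ℕ, g 0 (n * t) - g 0 0 := by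
      rw [hsplit]
      ring
    rw [hs, if_pos rfl, bernoulliFun_eval_one, bernoulliFun_eval_zero]
    norm_num
    ring
  · rw [if_neg hp, hsplit, bernoulliFun_endpoints_eq_of_ne_one (by omega)]
    ring

/-- The coefficients of the Euler–Maclaurin expansion of `t ↦ ∑ n, f (n t)` at `t = 0`, where
`d = f^{(j)}(0)`. -/
def eulerMaclaurinCoeff (j : ℕ) (d : ℂ) : ℂ :=
  -((bernoulli (j + 1) : ℂ) / ((j + 1).factorial : ℂ)) * d

lemma tsum_comp_natCast_mul_eq (hε : 0 < ε)
    (hd : ∀ p, ∀ w ∈ rightSector ε, HasDerivAt (g p) (g (p + 1) w) w)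
    (hb : ∀ p, ∃ C, ∀ w ∈ rightSector ε, ‖g p w‖ ≤ C * Real.exp (-w.re))
    {t : ℂ} (ht : t ∈ rightSector ε) (h0 : t ≠ 0) (p : ℕ) :
    ∑' n : ℕ, g 0 (n * t) = ∑' n, bernoulliIntegral 0 (g 0) t n +
      ∑ j ∈ Finset.range (p + 1), eulerMaclaurinCoeff j (g j 0) * t ^ j +
      (-1) ^ p * t ^ (p + 1) * ∑' n, bernoulliIntegral (p + 1) (g (p + 1)) t n := by
  induction p with
  | zero =>
    have h := tsum_bernoulliIntegral_succ hε hd hb 0 ht h0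
    rw [if_pos rfl, bernoulliFun_eval_one, bernoulliFun_eval_zero] at h
    rw [h]
    norm_num [eulerMaclaurinCoeff]
    ring
  | succ p ih =>
    rw [ih, Finset.sum_range_succ _ (p + 1), tsum_bernoulliIntegral_succ hε hd hb (p + 1) ht h0,
      if_neg p.succ_ne_zero, bernoulliFun_endpoints_eq_of_ne_one (by omega),
      bernoulliFun_eval_zero, eulerMaclaurinCoeff]
    -- The recursion produces the sign `(-1)^{p+1}`, the coefficient a fixed minus sign. They agree
    -- for even `p`; for odd `p` the Bernoulli number `B_{p+2}` vanishes.
    rcases Nat.even_or_odd p with hp | hp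
    · rw [pow_succ (-1 : ℂ) p, hp.neg_one_pow]
      push_cast
      ring
    · rw [pow_succ (-1 : ℂ) p, hp.neg_one_pow,
        bernoulli_eq_zero_of_odd (n := p + 1 + 1) (hp.add_even even_two) (by omega)]
      push_cast
      ring

/-- The Euler–Maclaurin expansion of `t ↦ ∑ n, f (n t)` as `t → 0` in a sector, where `g p` is the
`p`-th derivative of `f`. -/
theorem norm_tsum_sub_eulerMaclaurin_le (hε : 0 < ε)
    (hd : ∀ p, ∀ w ∈ rightSector ε, HasDerivAt (g p) (g (p + 1) w) w)
    (hb : ∀ p, ∃ C, ∀ w ∈ rightSector ε, ‖g p w‖ ≤ C * Real.exp (-w.re)) (p : ℕ) :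
    ∃ M : ℝ, ∀ t ∈ rightSector ε, t ≠ 0 → ‖t‖ ≤ 1 →
      ‖∑' n : ℕ, g 0 (n * t) - ∑' n, bernoulliIntegral 0 (g 0) t n -
        ∑ j ∈ Finset.range (p + 1), eulerMaclaurinCoeff j (g j 0) * t ^ j‖ ≤ M * ‖t‖ ^ p := by
  obtain ⟨C, hC⟩ := hb (p + 1)
  obtain ⟨M, hM⟩ := norm_tsum_bernoulliIntegral_le hε (p + 1) hC
  refine ⟨M, fun t ht h0 h1 => ?_⟩
  have htn : ‖t‖ ≠ 0 := norm_ne_zero_iff.mpr h0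
  rw [tsum_comp_natCast_mul_eq hε hd hb ht h0 p]
  calc _ = ‖t‖ ^ (p + 1) * ‖∑' n, bernoulliIntegral (p + 1) (g (p + 1)) t n‖ := by
        rw [add_assoc, add_sub_cancel_left, add_sub_cancel_left]
        simp
    _ ≤ ‖t‖ ^ (p + 1) * (M / ‖t‖) := by
        gcongr
        exact hM t ht h0 h1
    _ = M * ‖t‖ ^ p := by
        field_simp
        ring

/-- The leading term of the Euler–Maclaurin expansion, for a function with a primitive. -/
theorem mul_tsum_bernoulliIntegral_zero (hε : 0 < ε) {f F : ℂ → ℂ} {C : ℝ}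
    (hF : ∀ w ∈ rightSector ε, w ≠ 0 → HasDerivAt F (f w) w)
    (hFc : ContinuousOn F (rightSector ε)) (hf : ContinuousOn f (rightSector ε))
    (hb : ∀ w ∈ rightSector ε, ‖F w‖ ≤ C * Real.exp (-w.re))
    {t : ℂ} (ht : t ∈ rightSector ε) (h0 : t ≠ 0) :
    t * ∑' n, bernoulliIntegral 0 f t n = -F 0 := by
  have hmaps : ∀ n : ℕ, Set.MapsTo (fun x : ℝ => ((n : ℂ) + x) * t) (Set.Icc 0 1)
      (rightSector ε) := fun n x hx => natCast_add_mul_mem_rightSector ht n hx.1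
  have hstep : ∀ n : ℕ, t * bernoulliIntegral 0 f t n = F ((n + 1 : ℕ) * t) - F (n * t) :=
    -- Each step is the fundamental theorem of calculus along the segment from `n t` to `(n+1) t`;
    -- `F` need only be continuous at the vertex `0`.
    fun n => by
      have h := intervalIntegral.integral_eq_sub_of_hasDerivAt_of_le (a := (0 : ℝ)) (b := 1)
        (f := fun x : ℝ => F (((n : ℂ) + x) * t)) (f' := fun x : ℝ => f ((n + x) * t) * t)
        zero_le_one (hFc.comp (by fun_prop) (hmaps n))
        (fun x hx => by
          have h1 : HasDerivAt (fun x : ℝ => ((n : ℂ) + x) * t) t x := by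
            simpa using (((hasDerivAt_id x).ofReal_comp).const_add (n : ℂ)).mul_const t
          refine (hF _ (hmaps n ⟨hx.1.le, hx.2.le⟩) (mul_ne_zero ?_ h0)).comp x h1
          have : (0 : ℝ) < n + x := by linarith [hx.1, (Nat.cast_nonneg n : (0 : ℝ) ≤ n)]
          exact_mod_cast this.ne')
        (ContinuousOn.intervalIntegrable (by
          rw [Set.uIcc_of_le zero_le_one]
          exact (hf.comp (by fun_prop) (hmaps n)).mul continuousOn_const))
      rw [bernoulliIntegral, ← intervalIntegral.integral_const_mul]
      push_cast
      push_cast at h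
      rw [add_zero] at h
      rw [← h]
      refine intervalIntegral.integral_congr fun x _ => ?_
      simp [mul_comm]
  have hs0 : Summable fun n : ℕ => F (n * t) := summable_comp_natCast_mul hε hb ht h0
  have hs1 : Summable fun n : ℕ => F ((n + 1 : ℕ) * t) :=
    (summable_nat_add_iff 1 (f := fun n : ℕ => F (n * t))).mpr hs0
  rw [← tsum_mul_left, tsum_congr hstep, hs1.tsum_sub hs0, hs0.tsum_eq_zero_add]
  simp

end EulerMaclaurin

end

/-! ### The weighted logarithm, its decay and its dilogarithm primitive -/

noncomputable section

lemma character_zero {N : ℕ} (hN : 2 ≤ N) (χ : DirichletCharacter ℂ N) : χ 0 = 0 :=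
  χ.map_zero' (by omega)

variable {N : ℕ} [NeZero N]

lemma one_sub_mem_slitPlane_of_norm_eq_one {z : ℂ} (hz : ‖z‖ = 1) (h1 : z ≠ 1) :
    1 - z ∈ Complex.slitPlane := by
  rw [Complex.mem_slitPlane_iff]
  by_contra! h
  obtain ⟨hre, him⟩ := h
  have hle := Complex.re_le_norm z
  have hzre : z.re = 1 := by
    simp only [Complex.sub_re, Complex.one_re] at hre
    linarith
  exact h1 (Complex.ext hzre (by simpa using him))

lemma stdAddChar_ne_one {j : ZMod N} (hj : j ≠ 0) : (ZMod.stdAddChar j : ℂ) ≠ 1 := fun h =>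
  hj (ZMod.injective_stdAddChar (h.trans (AddChar.map_zero_eq_one _).symm))

lemma norm_stdAddChar_mul_exp_neg (j : ZMod N) (w : ℂ) :
    ‖(ZMod.stdAddChar j : ℂ) * Complex.exp (-w)‖ = Real.exp (-w.re) := by
  rw [norm_mul, AddChar.norm_apply, one_mul, Complex.norm_exp, Complex.neg_re]

lemma norm_stdAddChar_mul_exp_neg_lt_one (j : ZMod N) {w : ℂ} (hw : 0 < w.re) :
    ‖(ZMod.stdAddChar j : ℂ) * Complex.exp (-w)‖ < 1 := by
  rw [norm_stdAddChar_mul_exp_neg, Real.exp_lt_one_iff]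
  linarith

lemma one_sub_mem_slitPlane_of_norm_lt_one {z : ℂ} (hz : ‖z‖ < 1) :
    1 - z ∈ Complex.slitPlane := by
  rw [sub_eq_add_neg]
  exact Complex.mem_slitPlane_of_norm_lt_one (by rwa [norm_neg])

lemma one_sub_stdAddChar_mul_exp_mem_slitPlane {j : ZMod N} (hj : j ≠ 0) {w : ℂ}
    (hw : 0 < w.re ∨ w = 0) :
    1 - (ZMod.stdAddChar j : ℂ) * Complex.exp (-w) ∈ Complex.slitPlane := by
  rcases hw with hw | rfl
  · exact one_sub_mem_slitPlane_of_norm_lt_one (norm_stdAddChar_mul_exp_neg_lt_one j hw)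
  · simpa using one_sub_mem_slitPlane_of_norm_eq_one (AddChar.norm_apply _ _)
      (stdAddChar_ne_one hj)

/-- `w ↦ ∑_j χ(j) log (1 - ζ_N^j e^{-w})`. -/
def weightedLog (χ : DirichletCharacter ℂ N) (w : ℂ) : ℂ :=
  ∑ j : ZMod N, χ j * Complex.log (1 - ZMod.stdAddChar j * Complex.exp (-w))

/-- The logarithmic derivative `w ↦ ∑_j χ(j) ζ_N^j e^{-w} / (1 - ζ_N^j e^{-w})`. -/
def weightedLogDeriv (χ : DirichletCharacter ℂ N) (w : ℂ) : ℂ :=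
  ∑ j : ZMod N, χ j * (ZMod.stdAddChar j * Complex.exp (-w) /
    (1 - ZMod.stdAddChar j * Complex.exp (-w)))

/-- The primitive `w ↦ ∑_j χ(j) Li₂(ζ_N^j e^{-w})`. -/
def weightedDilog (χ : DirichletCharacter ℂ N) (w : ℂ) : ℂ :=
  ∑ j : ZMod N, χ j *
    ∑' m : ℕ, (ZMod.stdAddChar j * Complex.exp (-w)) ^ m / (m : ℂ) ^ 2

lemma hasDerivAt_stdAddChar_mul_exp_neg (j : ZMod N) (w : ℂ) :
    HasDerivAt (fun w => (ZMod.stdAddChar j : ℂ) * Complex.exp (-w))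
      (-(ZMod.stdAddChar j * Complex.exp (-w))) w := by
  have h := ((Complex.hasDerivAt_exp (-w)).comp w (hasDerivAt_neg w)).const_mul
    (ZMod.stdAddChar j : ℂ)
  simpa [Function.comp_def] using h

lemma analyticAt_stdAddChar_mul_exp_neg (j : ZMod N) (w : ℂ) :
    AnalyticAt ℂ (fun w => (ZMod.stdAddChar j : ℂ) * Complex.exp (-w)) w := by
  fun_prop

/-- The only summand singular at `w = 0` is the one with `j = 0`, and its weight `χ(0)` is zero. -/
lemma analyticAt_weightedLog (hN : 2 ≤ N) (χ : DirichletCharacter ℂ N) {w : ℂ}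
    (hw : 0 < w.re ∨ w = 0) : AnalyticAt ℂ (weightedLog χ) w := by
  have h : AnalyticAt ℂ (fun w => ∑ j : ZMod N, χ j *
      Complex.log (1 - ZMod.stdAddChar j * Complex.exp (-w))) w := by
    refine Finset.analyticAt_fun_sum _ fun j _ => ?_
    rcases eq_or_ne j 0 with rfl | hj
    · simpa [character_zero hN χ] using analyticAt_const
    · exact analyticAt_const.mul ((analyticAt_const.sub
        (analyticAt_stdAddChar_mul_exp_neg j w)).clog
          (one_sub_stdAddChar_mul_exp_mem_slitPlane hj hw))
  exact h

lemma hasDerivAt_weightedLog (hN : 2 ≤ N) (χ : DirichletCharacter ℂ N) {w : ℂ}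
    (hw : ∀ j : ZMod N, j ≠ 0 →
      1 - (ZMod.stdAddChar j : ℂ) * Complex.exp (-w) ∈ Complex.slitPlane) :
    HasDerivAt (weightedLog χ) (weightedLogDeriv χ w) w := by
  have h : HasDerivAt (fun w => ∑ j : ZMod N, χ j *
      Complex.log (1 - ZMod.stdAddChar j * Complex.exp (-w))) (weightedLogDeriv χ w) w := by
    refine HasDerivAt.fun_sum fun j _ => ?_
    rcases eq_or_ne j 0 with rfl | hj
    · simpa [character_zero hN χ] using hasDerivAt_const w (0 : ℂ)
    · refine HasDerivAt.const_mul _ ?_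
      simpa using ((hasDerivAt_stdAddChar_mul_exp_neg j w).const_sub 1).clog (hw j hj)
  exact h

lemma re_pos_or_eq_zero_of_mem_rightSector {ε : ℝ} (hε : 0 < ε) {w : ℂ}
    (hw : w ∈ rightSector ε) : 0 < w.re ∨ w = 0 := by
  by_cases h : w = 0
  · exact Or.inr h
  · exact Or.inl (re_pos_of_mem_rightSector hε hw h)

lemma hasDerivAt_iteratedDeriv_of_analyticAt {f : ℂ → ℂ} {w : ℂ} (hf : AnalyticAt ℂ f w) (p : ℕ) :
    HasDerivAt (iteratedDeriv p f) (iteratedDeriv (p + 1) f w) w := by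
  rw [iteratedDeriv_succ]
  have h := hf.iterated_deriv p
  rw [← iteratedDeriv_eq_iterate] at h
  exact h.differentiableAt.hasDerivAt

lemma isCompact_rightSector_inter {ε : ℝ} (hε : 0 < ε) (c : ℝ) :
    IsCompact (rightSector ε ∩ {w | w.re ≤ c}) := by
  refine Metric.isCompact_of_isClosed_isBounded ?_ ?_
  · exact (isClosed_le (by fun_prop) Complex.continuous_re).inter
      (isClosed_le Complex.continuous_re continuous_const)
  · refine (Metric.isBounded_closedBall (x := (0 : ℂ)) (r := c / ε)).subset fun w hw => ?_
    have h1 : ε * ‖w‖ ≤ w.re := hw.1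
    have h2 : w.re ≤ c := hw.2
    rw [mem_closedBall_zero_iff, le_div_iff₀ hε]
    linarith

/-- An exponential decay bound passes to all derivatives, by Cauchy's estimate. -/
lemma exists_norm_iteratedDeriv_le_exp {f : ℂ → ℂ} {ε K : ℝ} (hε : 0 < ε)
    (hf : ∀ w : ℂ, 0 < w.re ∨ w = 0 → AnalyticAt ℂ f w)
    (hK : ∀ w : ℂ, 1 ≤ w.re → ‖f w‖ ≤ K * Real.exp (-w.re)) (p : ℕ) :
    ∃ C, ∀ w ∈ rightSector ε, ‖iteratedDeriv p f w‖ ≤ C * Real.exp (-w.re) := by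
  have hcont : ContinuousOn (iteratedDeriv p f) (rightSector ε ∩ {w | w.re ≤ 2}) := fun w hw =>
    (hasDerivAt_iteratedDeriv_of_analyticAt
      (hf w (re_pos_or_eq_zero_of_mem_rightSector hε hw.1)) p).continuousAt.continuousWithinAt
  obtain ⟨C₁, hC₁⟩ := (isCompact_rightSector_inter hε 2).exists_bound_of_continuousOn hcont
  have hC₁0 : 0 ≤ C₁ := (norm_nonneg _).trans (hC₁ 0 ⟨zero_mem_rightSector ε, by simp⟩)
  have hK0 : 0 ≤ K := by
    have := (norm_nonneg _).trans (hK 1 (by simp))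
    exact nonneg_of_mul_nonneg_left this (Real.exp_pos _)
  refine ⟨C₁ * Real.exp 2 + p.factorial * (K * Real.exp 1), fun w hw => ?_⟩
  rw [add_mul]
  -- The part `Re w ≤ 2` of the sector is compact. Beyond it, unit discs stay in `Re ≥ 1`, where
  -- `hK` applies, and Cauchy's estimate costs a factor `e`.
  rcases le_total w.re 2 with h2 | h2
  · refine (hC₁ w ⟨hw, h2⟩).trans ?_
    have : 1 ≤ Real.exp 2 * Real.exp (-w.re) := by
      rw [← Real.exp_add, Real.one_le_exp_iff]
      linarith
    have h3 : 0 ≤ p.factorial * (K * Real.exp 1) * Real.exp (-w.re) := by positivity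
    nlinarith
  · have h4 : ‖iteratedDeriv p f w‖ ≤
        p.factorial * (K * Real.exp 1 * Real.exp (-w.re)) / 1 ^ p := by
      have hre : ∀ z ∈ Metric.closedBall w 1, w.re - 1 ≤ z.re := fun z hz => by
        rw [Metric.mem_closedBall, dist_comm, dist_eq_norm] at hz
        have := (Complex.re_le_norm (w - z)).trans hz
        rw [Complex.sub_re] at this
        linarith
      refine Complex.norm_iteratedDeriv_le_of_forall_mem_sphere_norm_le p one_pos ?_ fun z hz => ?_
      · refine DifferentiableOn.diffContOnCl fun z hz => ?_
        rw [closure_ball _ one_ne_zero] at hz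
        exact (hf z (Or.inl (by linarith [hre z hz]))).differentiableAt.differentiableWithinAt
      · have hz' := hre z (Metric.sphere_subset_closedBall hz)
        refine (hK z (by linarith)).trans ?_
        rw [mul_assoc, ← Real.exp_add]
        gcongr
        linarith
    have h5 : 0 ≤ C₁ * Real.exp 2 * Real.exp (-w.re) := by positivity
    rw [one_pow, div_one] at h4
    linarith

lemma norm_weightedLog_le (χ : DirichletCharacter ℂ N) {w : ℂ} (hw : 1 ≤ w.re) :
    ‖weightedLog χ w‖ ≤ (∑ j : ZMod N, ‖χ j‖ * (3 / 2)) * Real.exp (-w.re) := by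
  rw [weightedLog, Finset.sum_mul]
  refine norm_sum_le_of_le _ fun j _ => ?_
  have hu := norm_stdAddChar_mul_exp_neg j w
  have hle : Real.exp (-w.re) ≤ 1 / 2 := by
    have h1 : Real.exp (-w.re) ≤ Real.exp (-1) := Real.exp_le_exp.mpr (by linarith)
    have h2 := Real.exp_neg_one_lt_half
    linarith
  have h := Complex.norm_log_one_add_half_le_self
    (z := -((ZMod.stdAddChar j : ℂ) * Complex.exp (-w))) (by rw [norm_neg, hu]; exact hle)
  rw [norm_neg, hu, ← sub_eq_add_neg] at h
  rw [norm_mul, mul_assoc]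
  gcongr

lemma exists_norm_iteratedDeriv_weightedLog_le (hN : 2 ≤ N) (χ : DirichletCharacter ℂ N)
    {ε : ℝ} (hε : 0 < ε) (p : ℕ) :
    ∃ C, ∀ w ∈ rightSector ε, ‖iteratedDeriv p (weightedLog χ) w‖ ≤ C * Real.exp (-w.re) :=
  exists_norm_iteratedDeriv_le_exp hε (fun _ hw => analyticAt_weightedLog hN χ hw)
    (fun _ hw => norm_weightedLog_le χ hw) p

lemma norm_dilog_term_le (j : ZMod N) {w : ℂ} (hw : 0 ≤ w.re) (m : ℕ) :
    ‖((ZMod.stdAddChar j : ℂ) * Complex.exp (-w)) ^ m / (m : ℂ) ^ 2‖ ≤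
      1 / (m : ℝ) ^ 2 * Real.exp (-w.re) := by
  -- The term `m = 0` is a division by zero, hence `0`, so the dilogarithm series in effect starts
  -- at `m = 1`.
  rcases eq_or_ne m 0 with rfl | hm
  · simp
  · rw [norm_div, norm_pow, norm_stdAddChar_mul_exp_neg, norm_pow, Complex.norm_natCast,
      div_mul_eq_mul_div, one_mul]
    gcongr
    exact pow_le_of_le_one (Real.exp_nonneg _) (by simpa using hw) hm

lemma summable_one_div_natCast_sq : Summable fun m : ℕ => 1 / (m : ℝ) ^ 2 :=
  Real.summable_one_div_nat_pow.mpr one_lt_two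

lemma summable_dilog_term (j : ZMod N) {w : ℂ} (hw : 0 ≤ w.re) :
    Summable fun m : ℕ => ((ZMod.stdAddChar j : ℂ) * Complex.exp (-w)) ^ m / (m : ℂ) ^ 2 :=
  Summable.of_norm_bounded (summable_one_div_natCast_sq.mul_right _) (norm_dilog_term_le j hw)

lemma norm_weightedDilog_le (χ : DirichletCharacter ℂ N) {w : ℂ} (hw : 0 ≤ w.re) :
    ‖weightedDilog χ w‖ ≤
      (∑ j : ZMod N, ‖χ j‖ * ∑' m : ℕ, 1 / (m : ℝ) ^ 2) * Real.exp (-w.re) := by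
  rw [weightedDilog, Finset.sum_mul]
  refine norm_sum_le_of_le _ fun j _ => ?_
  rw [norm_mul, mul_assoc]
  gcongr
  exact tsum_of_norm_bounded (summable_one_div_natCast_sq.hasSum.mul_right _)
    (norm_dilog_term_le j hw)

lemma continuousOn_weightedDilog (χ : DirichletCharacter ℂ N) :
    ContinuousOn (weightedDilog χ) {w | 0 ≤ w.re} := by
  have h : ContinuousOn (fun w => ∑ j : ZMod N, χ j *
      ∑' m : ℕ, (ZMod.stdAddChar j * Complex.exp (-w)) ^ m / (m : ℂ) ^ 2) {w | 0 ≤ w.re} := by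
    refine continuousOn_finsetSum _ fun j _ => continuousOn_const.mul ?_
    refine continuousOn_tsum (fun m => by fun_prop) summable_one_div_natCast_sq fun m w hw => ?_
    refine (norm_dilog_term_le j hw m).trans ?_
    have : Real.exp (-w.re) ≤ 1 := by simpa using hw
    exact mul_le_of_le_one_right (by positivity) this
  exact h

lemma hasDerivAt_dilog (j : ZMod N) {w : ℂ} (hw : 0 < w.re) :
    HasDerivAt (fun w => ∑' m : ℕ, ((ZMod.stdAddChar j : ℂ) * Complex.exp (-w)) ^ m / (m : ℂ) ^ 2)
      (Complex.log (1 - ZMod.stdAddChar j * Complex.exp (-w))) w := by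
  set δ := w.re / 2 with hδ
  have hδ0 : 0 < δ := by positivity
  have hlt : Real.exp (-δ) < 1 := by
    rw [Real.exp_lt_one_iff]
    linarith
  have hsum : HasSum (fun m : ℕ => -(((ZMod.stdAddChar j : ℂ) * Complex.exp (-w)) ^ m / (m : ℂ)))
      (Complex.log (1 - ZMod.stdAddChar j * Complex.exp (-w))) := by
    simpa using (Complex.hasSum_taylorSeries_neg_log
      (norm_stdAddChar_mul_exp_neg_lt_one j hw)).neg
  rw [← hsum.tsum_eq]
  have hmem : w ∈ {z : ℂ | δ < z.re} := by
    change δ < w.re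
    linarith
  -- Termwise differentiation on the half-plane `Re z > Re w / 2`, where the derivatives have a
  -- common geometric majorant.
  refine hasDerivAt_tsum_of_isPreconnected (u := fun m : ℕ => Real.exp (-δ) ^ m)
    (t := {z : ℂ | δ < z.re}) (y₀ := w)
    (g := fun (m : ℕ) z => ((ZMod.stdAddChar j : ℂ) * Complex.exp (-z)) ^ m / (m : ℂ) ^ 2)
    (g' := fun (m : ℕ) z => -(((ZMod.stdAddChar j : ℂ) * Complex.exp (-z)) ^ m / (m : ℂ)))
    (summable_geometric_of_lt_one (Real.exp_nonneg _) hlt)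
    (isOpen_lt continuous_const Complex.continuous_re)
    (convex_halfSpace_re_gt δ).isPreconnected ?_ ?_ hmem (summable_dilog_term j hw.le) hmem
  · intro m z _
    rcases eq_or_ne m 0 with rfl | hm
    · simpa using hasDerivAt_const z (0 : ℂ)
    have h := ((hasDerivAt_stdAddChar_mul_exp_neg j z).fun_pow m).div_const ((m : ℂ) ^ 2)
    have hm' : (m : ℂ) ≠ 0 := by exact_mod_cast hm
    have e : (m : ℂ) * ((ZMod.stdAddChar j : ℂ) * Complex.exp (-z)) ^ (m - 1) *
        -(ZMod.stdAddChar j * Complex.exp (-z)) / (m : ℂ) ^ 2 =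
        -(((ZMod.stdAddChar j : ℂ) * Complex.exp (-z)) ^ m / (m : ℂ)) := by
      rw [← pow_sub_one_mul hm ((ZMod.stdAddChar j : ℂ) * Complex.exp (-z))]
      field_simp
    exact h.congr_deriv e
  · intro m z hz
    rw [norm_neg, norm_div, norm_pow, norm_stdAddChar_mul_exp_neg, Complex.norm_natCast]
    have hz' : δ < z.re := hz
    rcases eq_or_ne m 0 with rfl | hm
    · simp
    · refine (div_le_self (by positivity) (by exact_mod_cast Nat.one_le_iff_ne_zero.mpr hm)).trans ?_
      gcongr

lemma hasDerivAt_weightedDilog (χ : DirichletCharacter ℂ N) {w : ℂ} (hw : 0 < w.re) :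
    HasDerivAt (weightedDilog χ) (weightedLog χ w) w := by
  have h : HasDerivAt (fun w => ∑ j : ZMod N, χ j *
      ∑' m : ℕ, (ZMod.stdAddChar j * Complex.exp (-w)) ^ m / (m : ℂ) ^ 2) (weightedLog χ w) w :=
    HasDerivAt.fun_sum fun j _ => (hasDerivAt_dilog j hw).const_mul _
  exact h

/-- The Euler–Maclaurin expansion of `t ↦ ∑_n weightedLog χ (n t)`. -/
theorem norm_tsum_weightedLog_sub_le (hN : 2 ≤ N) (χ : DirichletCharacter ℂ N) {ε : ℝ}
    (hε : 0 < ε) (p : ℕ) :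
    ∃ M : ℝ, ∀ t ∈ rightSector ε, t ≠ 0 → ‖t‖ ≤ 1 →
      ‖∑' n : ℕ, weightedLog χ (n * t) - -weightedDilog χ 0 / t -
        ∑ j ∈ Finset.range (p + 1),
          eulerMaclaurinCoeff j (iteratedDeriv j (weightedLog χ) 0) * t ^ j‖ ≤ M * ‖t‖ ^ p := by
  have han : ∀ w ∈ rightSector ε, AnalyticAt ℂ (weightedLog χ) w := fun w hw =>
    analyticAt_weightedLog hN χ (re_pos_or_eq_zero_of_mem_rightSector hε hw)
  obtain ⟨M, hM⟩ := norm_tsum_sub_eulerMaclaurin_le (g := fun p => iteratedDeriv p (weightedLog χ))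
    hε (fun p w hw => hasDerivAt_iteratedDeriv_of_analyticAt (han w hw) p)
    (exists_norm_iteratedDeriv_weightedLog_le hN χ hε) p
  refine ⟨M, fun t ht h0 h1 => ?_⟩
  have hlead := mul_tsum_bernoulliIntegral_zero hε (f := weightedLog χ) (F := weightedDilog χ)
    (fun w hw hw0 => hasDerivAt_weightedDilog χ (re_pos_of_mem_rightSector hε hw hw0))
    ((continuousOn_weightedDilog χ).mono fun w hw => re_nonneg_of_mem_rightSector hε hw)
    (fun w hw => (han w hw).continuousAt.continuousWithinAt)
    (fun w hw => norm_weightedDilog_le χ (re_nonneg_of_mem_rightSector hε hw)) ht h0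
  have h := hM t ht h0 h1
  simp only [iteratedDeriv_zero] at h
  rwa [show -weightedDilog χ 0 / t = ∑' n, bernoulliIntegral 0 (weightedLog χ) t n by
    rw [← hlead]
    field_simp]

/-! ### Passage from the Pochhammer symbols to the sum of weighted logarithms -/

lemma sum_Icc_natCast_zmod {M : Type*} [AddCommMonoid M] (f : ZMod N → M) :
    ∑ k ∈ Finset.Icc 1 N, f (k : ZMod N) = ∑ j : ZMod N, f j := by
  have hN : 0 < N := Nat.pos_of_ne_zero (NeZero.ne N)
  refine Finset.sum_bij (fun k _ => (k : ZMod N)) (fun _ _ => Finset.mem_univ _) ?_ ?_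
    (fun _ _ => rfl)
  · intro a ha b hb hab
    rw [Finset.mem_Icc] at ha hb
    rw [ZMod.natCast_eq_natCast_iff] at hab
    rcases le_total a b with h | h
    · have := (Nat.modEq_iff_dvd' h).mp hab
      have := Nat.eq_zero_of_dvd_of_lt this (by omega)
      omega
    · have := (Nat.modEq_iff_dvd' h).mp hab.symm
      have := Nat.eq_zero_of_dvd_of_lt this (by omega)
      omega
  · intro j _
    rcases eq_or_ne j 0 with rfl | hj
    · exact ⟨N, by simp; omega, by simp⟩
    · refine ⟨j.val, ?_, by simp⟩
      rw [Finset.mem_Icc]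
      exact ⟨Nat.pos_of_ne_zero (by simpa [ZMod.val_eq_zero] using hj), (ZMod.val_lt j).le⟩

lemma summable_log_one_sub_stdAddChar_mul_exp (j : ZMod N) {t : ℂ} (ht : 0 < t.re) :
    Summable fun n : ℕ =>
      Complex.log (1 - (ZMod.stdAddChar j : ℂ) * Complex.exp (-((n : ℂ) * t))) := by
  have hlt : Real.exp (-t.re) < 1 := by
    rw [Real.exp_lt_one_iff]
    linarith
  have hu : Summable fun n : ℕ => -((ZMod.stdAddChar j : ℂ) * Complex.exp (-((n : ℂ) * t))) := by
    refine Summable.of_norm_bounded (summable_geometric_of_lt_one (Real.exp_nonneg _) hlt)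
      fun n => ?_
    rw [norm_neg, norm_stdAddChar_mul_exp_neg, ← Real.exp_nat_mul]
    simp
  simpa [sub_eq_add_neg] using Complex.summable_log_one_add_of_summable hu

lemma weightedSum_eq_tsum (χ : DirichletCharacter ℂ N) {y : ℂ} (hy : 0 < y.im) :
    weightedSum χ y = ∑' n : ℕ, weightedLog χ (n * (-(2 * Real.pi * Complex.I) * y)) := by
  set t := -(2 * Real.pi * Complex.I) * y with ht
  have htre : 0 < t.re := by
    have : t.re = 2 * Real.pi * y.im := by
      simp [ht]
    rw [this]
    positivity
  have hk : ∀ k : ℕ, logQPochhammer N k y = ∑' n : ℕ,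
      Complex.log (1 - (ZMod.stdAddChar (k : ZMod N) : ℂ) * Complex.exp (-((n : ℂ) * t))) :=
    fun k => by
      rw [logQPochhammer]
      refine tsum_congr fun n => ?_
      have h1 := ZMod.stdAddChar_coe (N := N) (k : ℤ)
      push_cast at h1
      rw [h1, ← Complex.exp_nat_mul]
      congr 4
      rw [ht]
      ring
  have hsum : weightedSum χ y = ∑ j : ZMod N, χ j * ∑' n : ℕ,
      Complex.log (1 - (ZMod.stdAddChar j : ℂ) * Complex.exp (-((n : ℂ) * t))) := by
    rw [← sum_Icc_natCast_zmod fun j : ZMod N => χ j * ∑' n : ℕ,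
      Complex.log (1 - (ZMod.stdAddChar j : ℂ) * Complex.exp (-((n : ℂ) * t)))]
    exact Finset.sum_congr rfl fun k _ => by rw [hk]
  rw [hsum]
  simp only [weightedLog]
  rw [Summable.tsum_finsetSum
    fun j _ => (summable_log_one_sub_stdAddChar_mul_exp j htre).mul_left _]
  simp only [tsum_mul_left]

end

/-! ### Calculus of simple poles and the divisor sum of residues -/

noncomputable section

/-- `f` has at `a` at most a simple pole, with residue `c`. -/
def HasSimplePoleAt (f : ℂ → ℂ) (a c : ℂ) : Prop :=
  ∃ h : ℂ → ℂ, AnalyticAt ℂ h a ∧ ∀ᶠ z in 𝓝[≠] a, f z = c / (z - a) + h z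

lemma AnalyticAt.hasSimplePoleAt {f : ℂ → ℂ} {a : ℂ} (hf : AnalyticAt ℂ f a) :
    HasSimplePoleAt f a 0 :=
  ⟨f, hf, by simp⟩

lemma HasSimplePoleAt.add {f g : ℂ → ℂ} {a c d : ℂ} (hf : HasSimplePoleAt f a c)
    (hg : HasSimplePoleAt g a d) : HasSimplePoleAt (fun z => f z + g z) a (c + d) := by
  obtain ⟨h, hh, hfh⟩ := hf
  obtain ⟨k, hk, hgk⟩ := hg
  refine ⟨fun z => h z + k z, hh.add hk, ?_⟩
  filter_upwards [hfh, hgk] with z h1 h2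
  rw [h1, h2]
  ring

lemma HasSimplePoleAt.const_mul {f : ℂ → ℂ} {a c : ℂ} (hf : HasSimplePoleAt f a c) (b : ℂ) :
    HasSimplePoleAt (fun z => b * f z) a (b * c) := by
  obtain ⟨h, hh, hfh⟩ := hf
  refine ⟨fun z => b * h z, analyticAt_const.mul hh, ?_⟩
  filter_upwards [hfh] with z h1
  rw [h1]
  ring

lemma HasSimplePoleAt.sum {ι : Type*} (s : Finset ι) {f : ι → ℂ → ℂ} {a : ℂ} {c : ι → ℂ}
    (hf : ∀ i ∈ s, HasSimplePoleAt (f i) a (c i)) :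
    HasSimplePoleAt (fun z => ∑ i ∈ s, f i z) a (∑ i ∈ s, c i) := by
  classical
  induction s using Finset.induction_on with
  | empty => simpa using (analyticAt_const (v := (0 : ℂ))).hasSimplePoleAt
  | insert i s hi ih =>
    simp only [Finset.sum_insert hi]
    exact (hf i (Finset.mem_insert_self i s)).add
      (ih fun k hk => hf k (Finset.mem_insert_of_mem hk))

lemma HasSimplePoleAt.congr {f g : ℂ → ℂ} {a c : ℂ} (hf : HasSimplePoleAt f a c)
    (hfg : ∀ᶠ z in 𝓝[≠] a, g z = f z) : HasSimplePoleAt g a c := by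
  obtain ⟨h, hh, hfh⟩ := hf
  refine ⟨h, hh, ?_⟩
  filter_upwards [hfh, hfg] with z h1 h2
  rw [h2, h1]

lemma AnalyticAt.dslope_self {f : ℂ → ℂ} {a : ℂ} (hf : AnalyticAt ℂ f a) :
    AnalyticAt ℂ (dslope f a) a := by
  obtain ⟨p, hp⟩ := hf
  exact ⟨_, hp.has_fpower_series_dslope_fslope⟩

lemma hasSimplePoleAt_div_sub {r : ℂ → ℂ} {a : ℂ} (hr : AnalyticAt ℂ r a) :
    HasSimplePoleAt (fun z => r z / (z - a)) a (r a) := by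
  refine ⟨dslope r a, hr.dslope_self, ?_⟩
  filter_upwards [self_mem_nhdsWithin] with z hz
  have hza : z - a ≠ 0 := sub_ne_zero.mpr hz
  have h := sub_smul_dslope r a z
  rw [smul_eq_mul] at h
  field_simp
  rw [h]
  ring

/-- Factor `f z = (z - a) · dslope f a z`; the second factor is analytic with value `c ≠ 0` at `a`.
-/
lemma hasSimplePoleAt_div {p f : ℂ → ℂ} {a c : ℂ} (hp : AnalyticAt ℂ p a) (hf : AnalyticAt ℂ f a)
    (hfa : f a = 0) (hc : HasDerivAt f c a) (hc0 : c ≠ 0) :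
    HasSimplePoleAt (fun z => p z / f z) a (p a / c) := by
  have hq : dslope f a a = c := by rw [dslope_same, hc.deriv]
  have h := hasSimplePoleAt_div_sub (hp.div hf.dslope_self (by rwa [hq]))
  simp only [Pi.div_apply, hq] at h
  refine h.congr ?_
  filter_upwards [self_mem_nhdsWithin] with z hz
  have h := sub_smul_dslope f a z
  rw [smul_eq_mul, hfa, sub_zero] at h
  rw [← h, div_div, mul_comm]

lemma HasSimplePoleAt.comp_div {f : ℂ → ℂ} {a c k : ℂ} (hk : k ≠ 0)
    (hf : HasSimplePoleAt f (a / k) c) :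
    HasSimplePoleAt (fun z => f (z / k) / k ^ 2) a (c / k) := by
  obtain ⟨h, hh, hfh⟩ := hf
  refine ⟨fun z => h (z / k) / k ^ 2, ?_, ?_⟩
  · exact (AnalyticAt.comp (f := fun z => z / k) hh (by fun_prop)).div analyticAt_const
      (pow_ne_zero 2 hk)
  · have ht : Tendsto (fun z : ℂ => z / k) (𝓝[≠] a) (𝓝[≠] (a / k)) := by
      refine tendsto_nhdsWithin_of_tendsto_nhds_of_eventually_within _ ?_ ?_
      · exact ((continuous_id.div_const k).tendsto a).mono_left nhdsWithin_le_nhds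
      · filter_upwards [self_mem_nhdsWithin] with z hz h0
        exact hz ((div_left_inj' hk).mp h0)
    filter_upwards [ht.eventually hfh, self_mem_nhdsWithin] with z h1 hz
    have hza : z - a ≠ 0 := sub_ne_zero.mpr hz
    rw [h1, ← sub_div]
    field_simp

/-- This is the total residue at `2πi m/N` of the terms `D(ξ/k)/k²` with `k = e + 1`. The divisor
`k` is complementary to the `d` in the Stokes constant, and oddness of `χ` matches the sign for
negative `m`. -/
lemma sum_range_ite_dvd_eq {N : ℕ} (χ : DirichletCharacter ℂ N) (hodd : χ.Odd) {m : ℤ}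
    (hm : m ≠ 0) {E : ℕ} (hE : m.natAbs ≤ E) :
    ∑ e ∈ Finset.range E, (if ((e + 1 : ℕ) : ℤ) ∣ m then
      χ ((m / (e + 1 : ℕ) : ℤ) : ZMod N) / (e + 1 : ℕ) else 0) = stokesConstant χ m / 2 := by
  have h1 : stokesConstant χ m / 2 = ∑ k ∈ m.natAbs.divisors,
      ((m.natAbs / k : ℕ) : ℂ) / (m : ℂ) * χ ((m.natAbs / k : ℕ) : ZMod N) := by
    rw [stokesConstant, mul_div_cancel_left₀ _ two_ne_zero,
      ← Nat.sum_div_divisors m.natAbs fun d => (d : ℂ) / (m : ℂ) * χ (d : ZMod N)]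
  have h2 : ∀ k ∈ m.natAbs.divisors, ((m.natAbs / k : ℕ) : ℂ) / (m : ℂ) *
      χ ((m.natAbs / k : ℕ) : ZMod N) = χ ((m / k : ℤ) : ZMod N) / k := fun k hk => by
    have hk0 : k ≠ 0 := (Nat.pos_of_mem_divisors hk).ne'
    have hk0' : (k : ℂ) ≠ 0 := by exact_mod_cast hk0
    obtain ⟨n, hn⟩ := Nat.dvd_of_mem_divisors hk
    have hn0 : (n : ℂ) ≠ 0 := by
      rintro h
      rw [Nat.cast_eq_zero] at h
      rw [h, mul_zero, Int.natAbs_eq_zero] at hn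
      exact hm hn
    rw [hn, Nat.mul_div_cancel_left _ (Nat.pos_of_ne_zero hk0)]
    rcases Int.natAbs_eq m with h | h <;> rw [h, hn]
    · rw [Nat.cast_mul, Int.mul_ediv_cancel_left _ (by exact_mod_cast hk0)]
      push_cast
      field_simp
    · rw [Nat.cast_mul, ← mul_neg, Int.mul_ediv_cancel_left _ (by exact_mod_cast hk0)]
      push_cast
      rw [hodd.eval_neg]
      field_simp
  rw [h1, Finset.sum_congr rfl h2, ← Finset.sum_filter]
  refine Finset.sum_bij (fun e _ => e + 1) ?_ ?_ ?_ ?_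
  · intro e he
    rw [Finset.mem_filter] at he
    rw [Nat.mem_divisors]
    exact ⟨Int.natCast_dvd.mp he.2, by simpa using hm⟩
  · intro a _ b _ hab
    omega
  · intro k hk
    have hk0 := Nat.pos_of_mem_divisors hk
    refine ⟨k - 1, ?_, by omega⟩
    rw [Finset.mem_filter, Finset.mem_range, Nat.sub_add_cancel hk0]
    have hle := Nat.divisor_le hk
    exact ⟨by omega, Int.natCast_dvd.mpr (Nat.dvd_of_mem_divisors hk)⟩
  · intro e _
    rfl

lemma HasSum.of_forall_eq {f g : ℕ → ℂ} {a : ℂ} (hf : HasSum f a) (h : ∀ n, g n = f n) :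
    HasSum g a := by
  rwa [funext h]

/-! ### Poles and parity of the logarithmic derivative -/

variable {N : ℕ} [NeZero N]

lemma stdAddChar_intCast (n : ℤ) :
    (ZMod.stdAddChar (n : ZMod N) : ℂ) = Complex.exp (n * (2 * Real.pi * Complex.I / N)) := by
  rw [ZMod.stdAddChar_coe]
  ring_nf

lemma stdAddChar_mul_exp_neg_eq_one_iff (j : ZMod N) (w : ℂ) :
    (ZMod.stdAddChar j : ℂ) * Complex.exp (-w) = 1 ↔
      ∃ n : ℤ, (n : ZMod N) = j ∧ w = n * (2 * Real.pi * Complex.I / N) := by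
  have hN0 : (N : ℂ) ≠ 0 := NeZero.ne _
  rw [Complex.exp_neg, mul_inv_eq_one₀ (Complex.exp_ne_zero w)]
  constructor
  · intro h
    obtain ⟨n, rfl⟩ := ZMod.intCast_surjective j
    rw [stdAddChar_intCast, eq_comm, Complex.exp_eq_exp_iff_exists_int] at h
    obtain ⟨k, hk⟩ := h
    refine ⟨n + k * N, by simp, ?_⟩
    rw [hk]
    push_cast
    field_simp
  · rintro ⟨n, rfl, rfl⟩
    exact stdAddChar_intCast n

lemma stdAddChar_mul_exp_neg_intCast_ne_one {j : ZMod N} {n : ℤ} (hj : j ≠ n) :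
    (ZMod.stdAddChar j : ℂ) * Complex.exp (-(n * (2 * Real.pi * Complex.I / N))) ≠ 1 := by
  rw [Complex.exp_neg, ← stdAddChar_intCast, Ne, mul_inv_eq_one₀ ?_]
  · exact fun h => hj (ZMod.injective_stdAddChar h)
  · rw [stdAddChar_intCast]
    exact Complex.exp_ne_zero _

lemma analyticAt_weightedLogDeriv_of_forall {χ : DirichletCharacter ℂ N} {w : ℂ}
    (hw : ∀ j : ZMod N, χ j ≠ 0 → (ZMod.stdAddChar j : ℂ) * Complex.exp (-w) ≠ 1) :
    AnalyticAt ℂ (weightedLogDeriv χ) w := by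
  have h : AnalyticAt ℂ (fun w => ∑ j : ZMod N, χ j * (ZMod.stdAddChar j * Complex.exp (-w) /
      (1 - ZMod.stdAddChar j * Complex.exp (-w)))) w := by
    refine Finset.analyticAt_fun_sum _ fun j _ => ?_
    by_cases hj : χ j = 0
    · simpa [hj] using analyticAt_const
    · exact analyticAt_const.mul ((analyticAt_stdAddChar_mul_exp_neg j w).fun_div
        (analyticAt_const.sub (analyticAt_stdAddChar_mul_exp_neg j w))
        (sub_ne_zero.mpr (hw j hj).symm))
  exact h

lemma analyticAt_weightedLogDeriv (hN : 2 ≤ N) (χ : DirichletCharacter ℂ N) {w : ℂ}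
    (hw : ∀ n : ℤ, n ≠ 0 → w ≠ n * (2 * Real.pi * Complex.I / N)) :
    AnalyticAt ℂ (weightedLogDeriv χ) w := by
  refine analyticAt_weightedLogDeriv_of_forall fun j hj h => ?_
  obtain ⟨n, rfl, hn⟩ := (stdAddChar_mul_exp_neg_eq_one_iff j w).mp h
  refine hw n ?_ hn
  rintro rfl
  exact hj (by simpa using character_zero hN χ)

/-- Only the summand with `j = n` is singular; there `u = ζ_N^j e^{-w}` equals `1` and `1 - u` has
derivative `u = 1`. -/
lemma hasSimplePoleAt_weightedLogDeriv (χ : DirichletCharacter ℂ N) (n : ℤ) :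
    HasSimplePoleAt (weightedLogDeriv χ) (n * (2 * Real.pi * Complex.I / N)) (χ n) := by
  classical
  set a : ℂ := n * (2 * Real.pi * Complex.I / N) with ha
  have h : HasSimplePoleAt (fun w => ∑ j : ZMod N, χ j * (ZMod.stdAddChar j * Complex.exp (-w) /
      (1 - ZMod.stdAddChar j * Complex.exp (-w)))) a
      (∑ j : ZMod N, χ j * if j = n then 1 else 0) := by
    refine HasSimplePoleAt.sum _ fun j _ => HasSimplePoleAt.const_mul ?_ _
    have hj := analyticAt_stdAddChar_mul_exp_neg j a
    split_ifs with hjn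
    · have h1 : (ZMod.stdAddChar j : ℂ) * Complex.exp (-a) = 1 :=
        (stdAddChar_mul_exp_neg_eq_one_iff j a).mpr ⟨n, hjn.symm, rfl⟩
      have h2 := hasSimplePoleAt_div (f := fun w => 1 - (ZMod.stdAddChar j : ℂ) * Complex.exp (-w))
        hj (analyticAt_const.sub hj) (by rw [h1, sub_self])
        ((hasDerivAt_stdAddChar_mul_exp_neg j a).const_sub 1) (by rw [h1]; norm_num)
      rw [h1] at h2
      simpa using h2
    · exact (hj.fun_div (analyticAt_const.sub hj)
        (sub_ne_zero.mpr (stdAddChar_mul_exp_neg_intCast_ne_one hjn).symm)).hasSimplePoleAt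
  rw [show ∑ j : ZMod N, (χ j * if j = n then 1 else 0) = χ n by simp] at h
  exact h

lemma analyticAt_weightedLogDeriv_zero (hN : 2 ≤ N) (χ : DirichletCharacter ℂ N) :
    AnalyticAt ℂ (weightedLogDeriv χ) 0 := by
  refine analyticAt_weightedLogDeriv_of_forall fun j hj => ?_
  rw [neg_zero, Complex.exp_zero, mul_one]
  refine stdAddChar_ne_one ?_
  rintro rfl
  exact hj (character_zero hN χ)

lemma eventually_one_sub_mem_slitPlane :
    ∀ᶠ w in 𝓝 (0 : ℂ), ∀ j : ZMod N, j ≠ 0 →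
      1 - (ZMod.stdAddChar j : ℂ) * Complex.exp (-w) ∈ Complex.slitPlane := by
  rw [eventually_all]
  intro j
  by_cases hj : j = 0
  · simp [hj]
  · have hc : ContinuousAt (fun w => 1 - (ZMod.stdAddChar j : ℂ) * Complex.exp (-w)) 0 := by
      fun_prop
    filter_upwards [hc.eventually_mem (Complex.isOpen_slitPlane.mem_nhds
      (one_sub_stdAddChar_mul_exp_mem_slitPlane hj (Or.inr rfl)))] with w hw _
    exact hw

lemma iteratedDeriv_succ_weightedLog (hN : 2 ≤ N) (χ : DirichletCharacter ℂ N) (n : ℕ) :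
    iteratedDeriv (n + 1) (weightedLog χ) 0 = iteratedDeriv n (weightedLogDeriv χ) 0 := by
  rw [iteratedDeriv_succ']
  refine Filter.EventuallyEq.iteratedDeriv_eq n ?_
  filter_upwards [eventually_one_sub_mem_slitPlane (N := N)] with w hw
  exact (hasDerivAt_weightedLog hN χ hw).deriv

/-- Replacing `(j, w)` by `(-j, -w)` inverts `u = ζ_N^j e^{-w}`, and `u⁻¹/(1 - u⁻¹) = -1 - u/(1 -
u)`. The constants `-1` cancel because `∑ χ(j) = 0`. -/
lemma weightedLogDeriv_neg (hN : 2 ≤ N) {χ : DirichletCharacter ℂ N} (hχ : χ ≠ 1) {w : ℂ}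
    (hw : ∀ j : ZMod N, j ≠ 0 →
      1 - (ZMod.stdAddChar j : ℂ) * Complex.exp (-w) ∈ Complex.slitPlane) :
    weightedLogDeriv χ (-w) = -χ (-1) * weightedLogDeriv χ w := by
  have hterm : ∀ j : ZMod N, χ (-j) * (ZMod.stdAddChar (-j) * Complex.exp (-(-w)) /
      (1 - ZMod.stdAddChar (-j) * Complex.exp (-(-w)))) =
      -χ (-1) * (χ j + χ j * (ZMod.stdAddChar j * Complex.exp (-w) /
        (1 - ZMod.stdAddChar j * Complex.exp (-w)))) := fun j => by
    rcases eq_or_ne j 0 with rfl | hj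
    · simp [character_zero hN χ]
    have hu : (ZMod.stdAddChar (-j) : ℂ) * Complex.exp (-(-w)) =
        ((ZMod.stdAddChar j : ℂ) * Complex.exp (-w))⁻¹ := by
      rw [mul_inv, ← Complex.exp_neg, AddChar.map_neg_eq_inv]
    have hu0 : (ZMod.stdAddChar j : ℂ) * Complex.exp (-w) ≠ 0 := by
      rw [← norm_ne_zero_iff, norm_stdAddChar_mul_exp_neg]
      exact (Real.exp_pos _).ne'
    have hu1 := Complex.slitPlane_ne_zero (hw j hj)
    rw [hu, neg_eq_neg_one_mul j, map_mul]
    generalize (ZMod.stdAddChar j : ℂ) * Complex.exp (-w) = u at hu0 hu1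
    have hu2 : u - 1 ≠ 0 := fun h => hu1 (by linear_combination -h)
    have e1 : u⁻¹ / (1 - u⁻¹) = 1 / (u - 1) := by
      rw [show 1 - u⁻¹ = (u - 1) / u by field_simp]
      field_simp
    have e2 : u / (1 - u) = -1 - 1 / (u - 1) := by
      rw [div_eq_iff hu1]
      field_simp
      ring
    rw [e1, e2]
    ring
  rw [weightedLogDeriv, ← Equiv.sum_comp (Equiv.neg (ZMod N))]
  simp only [Equiv.neg_apply]
  rw [Finset.sum_congr rfl fun j _ => hterm j, ← Finset.mul_sum, Finset.sum_add_distrib,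
    MulChar.sum_eq_zero_of_ne_one hχ, zero_add, weightedLogDeriv]

lemma iteratedDeriv_weightedLogDeriv_parity (hN : 2 ≤ N) {χ : DirichletCharacter ℂ N} (hχ : χ ≠ 1)
    (n : ℕ) : (-1) ^ n * iteratedDeriv n (weightedLogDeriv χ) 0 =
      -χ (-1) * iteratedDeriv n (weightedLogDeriv χ) 0 := by
  have h1 := iteratedDeriv_comp_neg n (weightedLogDeriv χ) 0
  rw [neg_zero, smul_eq_mul] at h1
  rw [← h1]
  have h2 : (fun w => weightedLogDeriv χ (-w)) =ᶠ[𝓝 0]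
      fun w => -χ (-1) * weightedLogDeriv χ w := by
    filter_upwards [eventually_one_sub_mem_slitPlane (N := N)] with w hw
    exact weightedLogDeriv_neg hN hχ hw
  rw [h2.iteratedDeriv_eq n, iteratedDeriv_const_mul_field]

lemma iteratedDeriv_weightedLogDeriv_eq_zero_of_odd (hN : 2 ≤ N) {χ : DirichletCharacter ℂ N}
    (hχ : χ ≠ 1) (hodd : χ.Odd) {n : ℕ} (hn : Odd n) :
    iteratedDeriv n (weightedLogDeriv χ) 0 = 0 := by
  have h := iteratedDeriv_weightedLogDeriv_parity hN hχ n
  rw [hn.neg_one_pow, show χ (-1) = -1 from hodd] at h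
  linear_combination -h / 2

lemma iteratedDeriv_weightedLogDeriv_eq_zero_of_even (hN : 2 ≤ N) {χ : DirichletCharacter ℂ N}
    (hχ : χ ≠ 1) (heven : χ.Even) {n : ℕ} (hn : Even n) :
    iteratedDeriv n (weightedLogDeriv χ) 0 = 0 := by
  have h := iteratedDeriv_weightedLogDeriv_parity hN hχ n
  rw [hn.neg_one_pow, show χ (-1) = 1 from heven] at h
  linear_combination h / 2

/-! ### The Borel sum: continuation, poles and Taylor series -/

/-- The Borel transform of the asymptotic series of `weightedSum χ`, summed in closed form. -/
def borelSum (χ : DirichletCharacter ℂ N) (ξ : ℂ) : ℂ :=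
  Complex.I / Real.pi *
    ∑' e : ℕ, weightedLogDeriv χ (ξ / (e + 1 : ℕ)) / ((e + 1 : ℕ) : ℂ) ^ 2

lemma exists_ball_weightedLogDeriv (hN : 2 ≤ N) (χ : DirichletCharacter ℂ N) :
    ∃ r > 0, DifferentiableOn ℂ (weightedLogDeriv χ) (Metric.ball 0 r) ∧
      ∃ M : ℝ, ∀ w ∈ Metric.ball (0 : ℂ) r, ‖weightedLogDeriv χ w‖ ≤ M := by
  have han := analyticAt_weightedLogDeriv_zero hN χ
  have h1 := han.eventually_analyticAt
  have h2 : ∀ᶠ w in 𝓝 (0 : ℂ), ‖weightedLogDeriv χ w‖ < ‖weightedLogDeriv χ 0‖ + 1 :=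
    han.continuousAt.norm.eventually_lt_const (by linarith)
  obtain ⟨r, hr, h⟩ := Metric.eventually_nhds_iff_ball.mp (h1.and h2)
  exact ⟨r, hr, fun w hw => (h w hw).1.differentiableAt.differentiableWithinAt, _,
    fun w hw => (h w hw).2.le⟩

lemma summable_one_div_natCast_add_one_sq (E : ℕ) :
    Summable fun e : ℕ => 1 / ((e + E + 1 : ℕ) : ℝ) ^ 2 := by
  simpa only [add_assoc] using (summable_nat_add_iff (f := fun m : ℕ => 1 / (m : ℝ) ^ 2)
    (E + 1)).mpr summable_one_div_natCast_sq

/-- For large `e` the points `ξ/(e+1)` with `ξ` near `ξ₀` lie in a disc where the logarithmic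
derivative is bounded, so the tail converges uniformly like `∑ 1/e²` and is analytic. All
singularities near `ξ₀` come from finitely many terms. -/
lemma borelSum_eq_sum_add (hN : 2 ≤ N) (χ : DirichletCharacter ℂ N) (ξ₀ : ℂ) (E₀ : ℕ) :
    ∃ E ≥ E₀, ∃ T : ℂ → ℂ, AnalyticAt ℂ T ξ₀ ∧ ∀ᶠ ξ in 𝓝 ξ₀, borelSum χ ξ =
      Complex.I / Real.pi * (∑ e ∈ Finset.range E,
        weightedLogDeriv χ (ξ / (e + 1 : ℕ)) / ((e + 1 : ℕ) : ℂ) ^ 2 + T ξ) := by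
  obtain ⟨r, hr, hdiff, M, hM⟩ := exists_ball_weightedLogDeriv hN χ
  set R := ‖ξ₀‖ + 1 with hR
  obtain ⟨E₁, hE₁⟩ := exists_nat_gt (R / r)
  set E := max E₀ E₁ with hE
  have hξ₀ : ξ₀ ∈ Metric.ball (0 : ℂ) R := by simp [hR]
  have hball : ∀ ξ ∈ Metric.ball (0 : ℂ) R, ∀ e : ℕ,
      ξ / ((e + E + 1 : ℕ) : ℂ) ∈ Metric.ball (0 : ℂ) r := fun ξ hξ e => by
    rw [mem_ball_zero_iff] at hξ ⊢
    rw [norm_div, Complex.norm_natCast, div_lt_iff₀ (by positivity)]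
    rw [div_lt_iff₀ hr] at hE₁
    have h1 : (E₁ : ℝ) ≤ ((e + E + 1 : ℕ) : ℝ) := by
      exact_mod_cast (le_max_right E₀ E₁).trans (by omega)
    nlinarith
  set f : ℕ → ℂ → ℂ := fun e ξ =>
    weightedLogDeriv χ (ξ / ((e + E + 1 : ℕ) : ℂ)) / ((e + E + 1 : ℕ) : ℂ) ^ 2 with hf
  have hbound : ∀ e : ℕ, ∀ ξ ∈ Metric.ball (0 : ℂ) R,
      ‖f e ξ‖ ≤ M * (1 / ((e + E + 1 : ℕ) : ℝ) ^ 2) := fun e ξ hξ => by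
    rw [hf]
    simp only [norm_div, norm_pow, Complex.norm_natCast]
    rw [mul_one_div]
    gcongr
    exact hM _ (hball ξ hξ e)
  have hsum := (summable_one_div_natCast_add_one_sq E).mul_left M
  have hT : DifferentiableOn ℂ (fun ξ => ∑' e, f e ξ) (Metric.ball 0 R) := by
    refine Complex.differentiableOn_tsum_of_summable_norm hsum (fun e => ?_) Metric.isOpen_ball
      hbound
    refine DifferentiableOn.div_const ?_ _
    exact hdiff.comp (by fun_prop) fun ξ hξ => hball ξ hξ e
  refine ⟨E, le_max_left _ _, fun ξ => ∑' e, f e ξ,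
    hT.analyticAt (Metric.isOpen_ball.mem_nhds hξ₀), ?_⟩
  filter_upwards [Metric.isOpen_ball.mem_nhds hξ₀] with ξ hξ
  have hs : Summable fun e : ℕ =>
      weightedLogDeriv χ (ξ / (e + 1 : ℕ)) / ((e + 1 : ℕ) : ℂ) ^ 2 :=
    (summable_nat_add_iff E).mp (Summable.of_norm_bounded hsum fun e => hbound e ξ hξ)
  rw [borelSum, ← hs.sum_add_tsum_nat_add E]

lemma two_pi_I_div_ne_zero : (2 * Real.pi * Complex.I / N : ℂ) ≠ 0 :=
  div_ne_zero Complex.two_pi_I_ne_zero (NeZero.ne _)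

lemma analyticAt_borelSum (hN : 2 ≤ N) (χ : DirichletCharacter ℂ N) {ξ : ℂ}
    (hξ : ∀ m : ℤ, m ≠ 0 → ξ ≠ m * (2 * Real.pi * Complex.I / N)) :
    AnalyticAt ℂ (borelSum χ) ξ := by
  obtain ⟨E, -, T, hT, h⟩ := borelSum_eq_sum_add hN χ ξ 0
  refine AnalyticAt.congr ?_ (EventuallyEq.symm h)
  refine analyticAt_const.mul ((Finset.analyticAt_fun_sum _ fun e _ => ?_).add hT)
  have he : ((e + 1 : ℕ) : ℂ) ≠ 0 := by exact_mod_cast e.succ_ne_zero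
  refine AnalyticAt.fun_div ?_ analyticAt_const (pow_ne_zero 2 he)
  refine AnalyticAt.comp (f := fun ξ : ℂ => ξ / ((e + 1 : ℕ) : ℂ))
    (analyticAt_weightedLogDeriv hN χ fun n hn h0 => ?_) (by fun_prop)
  refine hξ (n * (e + 1 : ℕ)) (mul_ne_zero hn (by exact_mod_cast e.succ_ne_zero)) ?_
  rw [div_eq_iff he] at h0
  rw [h0]
  push_cast
  ring

lemma hasSimplePoleAt_weightedLogDeriv_comp_div (hN : 2 ≤ N) (χ : DirichletCharacter ℂ N) {k : ℕ}
    (hk : k ≠ 0) (m : ℤ) :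
    HasSimplePoleAt (fun ξ => weightedLogDeriv χ (ξ / k) / (k : ℂ) ^ 2)
      (m * (2 * Real.pi * Complex.I / N))
      (if (k : ℤ) ∣ m then χ ((m / k : ℤ) : ZMod N) / k else 0) := by
  have hk0 : (k : ℂ) ≠ 0 := by exact_mod_cast hk
  split_ifs with hkm
  · refine HasSimplePoleAt.comp_div hk0 ?_
    obtain ⟨n, rfl⟩ := hkm
    rw [Int.mul_ediv_cancel_left _ (by exact_mod_cast hk)]
    convert hasSimplePoleAt_weightedLogDeriv χ n using 1
    push_cast
    field_simp
  · rw [← zero_div (k : ℂ)]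
    refine HasSimplePoleAt.comp_div hk0
      (analyticAt_weightedLogDeriv hN χ fun n _ h => hkm ?_).hasSimplePoleAt
    rw [div_eq_iff hk0] at h
    have h' : (m : ℂ) = n * k :=
      mul_right_cancel₀ (two_pi_I_div_ne_zero (N := N)) (h.trans (by ring))
    exact ⟨n, by rw [mul_comm]; exact_mod_cast h'⟩

lemma hasSimplePoleAt_borelSum (hN : 2 ≤ N) {χ : DirichletCharacter ℂ N} (hodd : χ.Odd) {m : ℤ}
    (hm : m ≠ 0) :
    HasSimplePoleAt (borelSum χ) (m * (2 * Real.pi * Complex.I / N))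
      (Complex.I / Real.pi * (stokesConstant χ m / 2)) := by
  -- Requiring `E ≥ |m|` puts every divisor of `m` into the finite part.
  obtain ⟨E, hE, T, hT, h⟩ := borelSum_eq_sum_add hN χ (m * (2 * Real.pi * Complex.I / N)) m.natAbs
  refine HasSimplePoleAt.congr ?_ (h.filter_mono nhdsWithin_le_nhds)
  rw [← sum_range_ite_dvd_eq χ hodd hm hE, ← add_zero (∑ e ∈ Finset.range E, _)]
  exact ((HasSimplePoleAt.sum _ fun e _ => hasSimplePoleAt_weightedLogDeriv_comp_div hN χ
    e.succ_ne_zero m).add hT.hasSimplePoleAt).const_mul _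

lemma hasSum_one_div_add_one_pow (n : ℕ) :
    HasSum (fun e : ℕ => 1 / ((e + 1 : ℕ) : ℂ) ^ (n + 2)) (riemannZeta (n + 2 : ℕ)) := by
  have hs : Summable fun e : ℕ => 1 / (e : ℂ) ^ (n + 2) := by
    refine Summable.of_norm ?_
    simp
  rw [zeta_nat_eq_tsum_of_gt_one (by omega), hs.tsum_eq_zero_add]
  simpa using ((summable_nat_add_iff 1).mpr hs).hasSum

/-- Expand each `D(ξ/k)/k²` in its Taylor series at `0` and exchange the sums: the powers `k^{-n-2}`
add up to `ζ(n+2)`. The double series is dominated by `|a_n ξ^n| / k²`. -/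
lemma eventually_hasSum_borelSum (hN : 2 ≤ N) (χ : DirichletCharacter ℂ N) :
    ∀ᶠ ξ in 𝓝 (0 : ℂ), HasSum (fun n : ℕ => Complex.I / Real.pi *
      (iteratedDeriv n (weightedLogDeriv χ) 0 / n.factorial * riemannZeta (n + 2 : ℕ)) * ξ ^ n)
      (borelSum χ ξ) := by
  obtain ⟨r, hr, hdiff, -⟩ := exists_ball_weightedLogDeriv hN χ
  filter_upwards [Metric.ball_mem_nhds (0 : ℂ) hr] with ξ hξ
  set a : ℕ → ℂ := fun n => iteratedDeriv n (weightedLogDeriv χ) 0 / n.factorial with ha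
  have hser : ∀ w ∈ Metric.ball (0 : ℂ) r,
      HasSum (fun n => a n * w ^ n) (weightedLogDeriv χ w) := fun w hw => by
    refine (Complex.hasSum_taylorSeries_on_ball hdiff hw).of_forall_eq fun n => ?_
    simp only [ha, sub_zero, smul_eq_mul]
    ring
  have hmem : ∀ e : ℕ, ξ / ((e + 1 : ℕ) : ℂ) ∈ Metric.ball (0 : ℂ) r := fun e => by
    rw [mem_ball_zero_iff] at hξ ⊢
    rw [norm_div, Complex.norm_natCast]
    refine (div_le_self (norm_nonneg _) ?_).trans_lt hξ
    exact_mod_cast Nat.succ_pos e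
  set F : ℕ → ℕ → ℂ := fun n e => a n * ξ ^ n * (1 / ((e + 1 : ℕ) : ℂ) ^ (n + 2)) with hF
  have hsum : Summable (Function.uncurry F) := by
    have h1 := (hser ξ hξ).summable.norm
    have h2 := summable_one_div_natCast_add_one_sq 0
    refine Summable.of_norm_bounded (h1.mul_of_nonneg h2 (fun n => norm_nonneg _)
      fun e => by positivity) ?_
    rintro ⟨n, e⟩
    simp only [Function.uncurry, hF, add_zero]
    rw [norm_mul]
    gcongr
    rw [norm_div, norm_one, norm_pow, Complex.norm_natCast]
    refine one_div_le_one_div_of_le (by positivity) ?_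
    exact pow_le_pow_right₀ (by exact_mod_cast Nat.succ_pos e) (by omega)
  have hinner : ∀ n, HasSum (F n) (a n * ξ ^ n * riemannZeta (n + 2 : ℕ)) := fun n =>
    (hasSum_one_div_add_one_pow n).mul_left _
  have hinner' : ∀ e, ∑' n, F n e =
      weightedLogDeriv χ (ξ / (e + 1 : ℕ)) / ((e + 1 : ℕ) : ℂ) ^ 2 := fun e => by
    have he : ((e + 1 : ℕ) : ℂ) ≠ 0 := by exact_mod_cast e.succ_ne_zero
    rw [← ((hser _ (hmem e)).div_const (((e + 1 : ℕ) : ℂ) ^ 2)).tsum_eq]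
    refine tsum_congr fun n => ?_
    simp only [hF]
    rw [div_pow, pow_add]
    field_simp
  have hout : HasSum (fun n => a n * ξ ^ n * riemannZeta (n + 2 : ℕ)) (∑' n, ∑' e, F n e) := by
    have := hsum.prod.hasSum
    simpa only [Function.uncurry, (hinner _).tsum_eq] using this
  have hB : borelSum χ ξ = Complex.I / Real.pi * ∑' n, ∑' e, F n e := by
    rw [borelSum, ← hsum.tsum_comm]
    simp only [hinner']
  rw [hB]
  refine (hout.mul_left (Complex.I / Real.pi)).of_forall_eq fun n => ?_
  ring

end

/-! ### Asymptotic expansions: truncation and uniqueness -/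

noncomputable section

instance nhdsWithin_upperSector_neBot : (𝓝[upperSector 1] (0 : ℂ)).NeBot := by
  rw [← mem_closure_iff_nhdsWithin_neBot, Metric.mem_closure_iff]
  intro r hr
  have hr2 : (0 : ℝ) < r / 2 := by positivity
  refine ⟨(r / 2 : ℝ) * Complex.I, ⟨?_, ?_⟩, ?_⟩
  · simpa using hr2
  · rw [norm_mul, Complex.norm_real, Real.norm_of_nonneg hr2.le]
    simp
  · rw [dist_zero_left, norm_mul, Complex.norm_real, Real.norm_of_nonneg hr2.le]
    simpa using hr

lemma ne_zero_of_mem_upperSector {ε : ℝ} {y : ℂ} (hy : y ∈ upperSector ε) : y ≠ 0 := by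
  rintro rfl
  simpa using hy.1

lemma isBigO_zpow_upperSector (ε : ℝ) {m n : ℤ} (h : m ≤ n) :
    (fun y : ℂ => y ^ n) =O[𝓝[upperSector ε] 0] fun y : ℂ => y ^ m := by
  refine IsBigO.of_bound 1 ?_
  filter_upwards [self_mem_nhdsWithin, nhdsWithin_le_nhds (Metric.closedBall_mem_nhds 0 one_pos)]
    with y hy hy1
  rw [mem_closedBall_zero_iff] at hy1
  rw [one_mul, norm_zpow, norm_zpow]
  exact zpow_le_zpow_right_of_le_one₀ (norm_pos_iff.mpr (ne_zero_of_mem_upperSector hy)) hy1 h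

/-- Lets two series be truncated from a common lower exponent when they are compared. -/
lemma sum_Ico_order_eq {φ : LaurentSeries ℂ} {M : ℤ} (hM : ∀ n < M, φ.coeff n = 0) (K : ℤ)
    (y : ℂ) : ∑ n ∈ Finset.Ico φ.order K, φ.coeff n * y ^ n =
      ∑ n ∈ Finset.Ico M K, φ.coeff n * y ^ n := by
  have key : ∀ M' : ℤ, (∀ n < M', φ.coeff n = 0) → min M φ.order ≤ M' →
      ∑ n ∈ Finset.Ico M' K, φ.coeff n * y ^ n =
        ∑ n ∈ Finset.Ico (min M φ.order) K, φ.coeff n * y ^ n := fun M' hM' hle => by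
    refine Finset.sum_subset (Finset.Ico_subset_Ico_left hle) fun n hn hn' => ?_
    rw [Finset.mem_Ico] at hn hn'
    rw [hM' n (by by_contra h; exact hn' ⟨by omega, hn.2⟩), zero_mul]
  rw [key _ (fun n hn => HahnSeries.coeff_eq_zero_of_lt_order hn) (min_le_right _ _),
    key M hM (min_le_left _ _)]

lemma hasAsymptoticExpansion_of_forall_nat {f : ℂ → ℂ} {φ : LaurentSeries ℂ} {M : ℤ}
    (hM : ∀ n < M, φ.coeff n = 0)
    (h : ∀ ε : ℝ, 0 < ε → ∀ p : ℕ, (fun y : ℂ => f y - ∑ n ∈ Finset.Ico M (p + 1 : ℤ),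
      φ.coeff n * y ^ n) =O[𝓝[upperSector ε] 0] fun y : ℂ => y ^ p) :
    HasAsymptoticExpansion f φ := by
  intro ε hε K
  have h0 : (fun y : ℂ => y ^ K.toNat) =O[𝓝[upperSector ε] 0] fun y : ℂ => y ^ K := by
    simpa only [zpow_natCast] using isBigO_zpow_upperSector ε (Int.self_le_toNat K)
  have h1 := (h ε hε K.toNat).trans h0
  -- The surplus terms of the longer truncation have exponent at least `K`, so they belong to the
  -- error.
  have h2 : (fun y : ℂ => ∑ n ∈ Finset.Ico (max M K) (K.toNat + 1 : ℤ), φ.coeff n * y ^ n)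
      =O[𝓝[upperSector ε] 0] fun y : ℂ => y ^ K :=
    IsBigO.fun_sum fun n hn => (isBigO_zpow_upperSector ε
      ((le_max_right M K).trans (Finset.mem_Ico.mp hn).1)).const_mul_left _
  refine (h1.add h2).congr_left fun y => ?_
  rw [sum_Ico_order_eq hM]
  have hK := Int.self_le_toNat K
  have h3 : ∑ n ∈ Finset.Ico M (K.toNat + 1 : ℤ), φ.coeff n * y ^ n =
      ∑ n ∈ Finset.Ico M K, φ.coeff n * y ^ n +
        ∑ n ∈ Finset.Ico (max M K) (K.toNat + 1 : ℤ), φ.coeff n * y ^ n := by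
    rcases le_total M K with hMK | hMK
    · rw [max_eq_right hMK, ← Finset.sum_union (Finset.Ico_disjoint_Ico_consecutive _ _ _),
        Finset.Ico_union_Ico_eq_Ico hMK (by omega)]
    · rw [max_eq_left hMK, Finset.Ico_eq_empty (by omega : ¬ M < K), Finset.sum_empty, zero_add]
  rw [h3]
  ring

lemma eq_zero_of_mul_zpow_isBigO {c : ℂ} {m : ℤ}
    (h : (fun y : ℂ => c * y ^ m) =O[𝓝[upperSector 1] 0] fun y : ℂ => y ^ (m + 1)) : c = 0 := by
  obtain ⟨C, hC⟩ := h.bound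
  have h1 : ∀ᶠ y in 𝓝[upperSector 1] (0 : ℂ), ‖c‖ ≤ C * ‖y‖ := by
    filter_upwards [hC, self_mem_nhdsWithin] with y hy hmem
    have hy0 := ne_zero_of_mem_upperSector hmem
    rw [zpow_add_one₀ hy0, norm_mul, norm_mul, mul_left_comm, mul_comm ‖c‖] at hy
    exact le_of_mul_le_mul_left hy (norm_pos_iff.mpr (zpow_ne_zero m hy0))
  have h2 : Tendsto (fun y : ℂ => C * ‖y‖) (𝓝[upperSector 1] 0) (𝓝 0) := by
    have : Tendsto (fun y : ℂ => C * ‖y‖) (𝓝 0) (𝓝 (C * ‖(0 : ℂ)‖)) :=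
      (continuous_const.mul continuous_norm).tendsto 0
    simpa using this.mono_left nhdsWithin_le_nhds
  exact norm_le_zero_iff.mp (ge_of_tendsto h2 h1)

/-- The asymptotic expansion of a function is unique. -/
theorem HasAsymptoticExpansion.unique {f : ℂ → ℂ} {φ ψ : LaurentSeries ℂ}
    (hφ : HasAsymptoticExpansion f φ) (hψ : HasAsymptoticExpansion f ψ) : φ = ψ := by
  set M := min φ.order ψ.order with hM
  have hφM : ∀ n < M, φ.coeff n = 0 := fun n hn =>
    HahnSeries.coeff_eq_zero_of_lt_order (hn.trans_le (min_le_left _ _))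
  have hψM : ∀ n < M, ψ.coeff n = 0 := fun n hn =>
    HahnSeries.coeff_eq_zero_of_lt_order (hn.trans_le (min_le_right _ _))
  have key : ∀ k : ℕ, ∀ n < M + k, φ.coeff n = ψ.coeff n := by
    intro k
    induction k with
    | zero =>
      intro n hn
      rw [Nat.cast_zero, add_zero] at hn
      rw [hφM n hn, hψM n hn]
    | succ k ih =>
      intro n hn
      rcases lt_or_ge n (M + k) with hlt | hge
      · exact ih n hlt
      obtain rfl : n = M + k := by
        push_cast at hn
        omega
      refine sub_eq_zero.mp (eq_zero_of_mul_zpow_isBigO (m := M + k) ?_)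
      -- In the difference of the two truncations the lower coefficients cancel by induction,
      -- leaving one monomial of degree `M + k` that is `O(y^{M+k+1})`.
      refine ((hψ 1 one_pos (M + k + 1)).sub (hφ 1 one_pos (M + k + 1))).congr_left fun y => ?_
      rw [sum_Ico_order_eq hφM, sum_Ico_order_eq hψM, sub_sub_sub_cancel_left,
        ← Finset.sum_sub_distrib, Finset.sum_eq_single (M + k : ℤ)]
      · ring
      · intro b hb hne
        rw [Finset.mem_Ico] at hb
        rw [ih b (by omega), sub_self]
      · intro h
        exact absurd (Finset.mem_Ico.mpr ⟨by omega, by omega⟩) h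
  ext n
  exact key (n - M + 1).toNat n (by have := Int.self_le_toNat (n - M + 1); omega)

/-- A convergent Borel transform forces the Gevrey-1 bound. -/
lemma IsBorelTransformNearZero.isGevreyOne {φ : LaurentSeries ℂ} {B : ℂ → ℂ}
    (h : IsBorelTransformNearZero φ B) : IsGevreyOne φ := by
  obtain ⟨r, hr, hB⟩ := Metric.eventually_nhds_iff_ball.mp h
  have hr2 : (0 : ℝ) < r / 2 := by positivity
  have hs := (hB ((r / 2 : ℝ) : ℂ) (by
    rw [mem_ball_zero_iff, Complex.norm_real, Real.norm_of_nonneg hr2.le]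
    linarith)).summable
  obtain ⟨C, hC⟩ := hs.tendsto_atTop_zero.norm.bddAbove_range
  refine ⟨max C 1, r / 2, by positivity, hr2, fun n => ?_⟩
  -- The terms of the convergent series at `r/2` tend to zero, hence are bounded; the maximum with
  -- `1` makes the constant positive.
  have h1 : ‖φ.coeff (n + 1) / (n.factorial : ℂ) * ((r / 2 : ℝ) : ℂ) ^ n‖ ≤ max C 1 :=
    (hC ⟨n, rfl⟩).trans (le_max_left _ _)
  rw [norm_mul, norm_div, norm_pow, Complex.norm_real, Real.norm_of_nonneg hr2.le,
    Complex.norm_natCast] at h1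
  have hf : (0 : ℝ) < n.factorial := by exact_mod_cast n.factorial_pos
  rw [inv_pow, ← div_eq_mul_inv, div_mul_eq_mul_div, le_div_iff₀ (by positivity)]
  rw [div_mul_eq_mul_div, div_le_iff₀ hf] at h1
  exact h1

/-! ### The expansion of the weighted sum, and the odd and even cases -/

variable {N : ℕ} [NeZero N]

/-- The coefficients of the asymptotic expansion of `weightedSum χ`. -/
def asymptoticCoeff (χ : DirichletCharacter ℂ N) : ℤ → ℂ
  | Int.ofNat j => eulerMaclaurinCoeff j (iteratedDeriv j (weightedLog χ) 0) *
      (-(2 * Real.pi * Complex.I)) ^ j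
  | Int.negSucc 0 => weightedDilog χ 0 / (2 * Real.pi * Complex.I)
  | Int.negSucc (_ + 1) => 0

lemma asymptoticCoeff_natCast (χ : DirichletCharacter ℂ N) (j : ℕ) :
    asymptoticCoeff χ j = eulerMaclaurinCoeff j (iteratedDeriv j (weightedLog χ) 0) *
      (-(2 * Real.pi * Complex.I)) ^ j := rfl

lemma asymptoticCoeff_neg_one (χ : DirichletCharacter ℂ N) :
    asymptoticCoeff χ (-1) = weightedDilog χ 0 / (2 * Real.pi * Complex.I) := rfl

lemma asymptoticCoeff_of_lt (χ : DirichletCharacter ℂ N) {n : ℤ} (hn : n < -1) :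
    asymptoticCoeff χ n = 0 := by
  obtain ⟨k, rfl⟩ : ∃ k : ℕ, n = Int.negSucc (k + 1) := ⟨(-n - 2).toNat, by omega⟩
  rfl

/-- The asymptotic expansion of `weightedSum χ`. -/
def asymptoticSeries (χ : DirichletCharacter ℂ N) : LaurentSeries ℂ :=
  HahnSeries.ofSuppBddBelow (asymptoticCoeff χ)
    ⟨-1, fun _ hn => not_lt.mp fun h => hn (asymptoticCoeff_of_lt χ h)⟩

lemma asymptoticSeries_coeff (χ : DirichletCharacter ℂ N) (n : ℤ) :
    (asymptoticSeries χ).coeff n = asymptoticCoeff χ n := rfl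

lemma sum_Ico_neg_one_asymptoticCoeff (χ : DirichletCharacter ℂ N) (p : ℕ) (y : ℂ) :
    ∑ n ∈ Finset.Ico (-1) (p + 1 : ℤ), asymptoticCoeff χ n * y ^ n =
      -weightedDilog χ 0 / (-(2 * Real.pi * Complex.I) * y) +
        ∑ j ∈ Finset.range (p + 1), eulerMaclaurinCoeff j (iteratedDeriv j (weightedLog χ) 0) *
          (-(2 * Real.pi * Complex.I) * y) ^ j := by
  induction p with
  | zero =>
    rw [show Finset.Ico (-1 : ℤ) (((0 : ℕ) : ℤ) + 1) = {-1, 0} by decide,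
      Finset.sum_pair (by norm_num), asymptoticCoeff_neg_one, zpow_neg_one,
      show asymptoticCoeff χ 0 = asymptoticCoeff χ ((0 : ℕ) : ℤ) from rfl, asymptoticCoeff_natCast]
    simp only [zero_add, Finset.sum_range_one, pow_zero, zpow_zero, mul_one]
    rw [neg_mul, neg_div_neg_eq, ← div_eq_mul_inv, div_div]
  | succ p ih =>
    rw [Finset.sum_range_succ, ← add_assoc, ← ih, Nat.cast_succ,
      ← Finset.sum_Ico_add_eq_sum_Ico_add_one (by omega)]
    congr 1
    rw [show ((p : ℤ) + 1) = ((p + 1 : ℕ) : ℤ) by push_cast; rfl, asymptoticCoeff_natCast,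
      zpow_natCast, mul_pow]
    ring

lemma hasAsymptoticExpansion_weightedSum (hN : 2 ≤ N) (χ : DirichletCharacter ℂ N) :
    HasAsymptoticExpansion (weightedSum χ) (asymptoticSeries χ) := by
  refine hasAsymptoticExpansion_of_forall_nat (M := -1)
    (fun n hn => asymptoticCoeff_of_lt χ hn) fun ε hε p => ?_
  obtain ⟨M, hM⟩ := norm_tsum_weightedLog_sub_le hN χ hε p
  refine IsBigO.of_bound (M * (2 * Real.pi) ^ p) ?_
  have hnear : ∀ᶠ y in 𝓝 (0 : ℂ), ‖-(2 * Real.pi * Complex.I) * y‖ < 1 := by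
    have hc : ContinuousAt (fun y : ℂ => ‖-(2 * Real.pi * Complex.I) * y‖) 0 := by fun_prop
    exact hc.eventually_lt_const (by simp)
  filter_upwards [self_mem_nhdsWithin, nhdsWithin_le_nhds hnear] with y hy hy1
  have hnorm : ‖-(2 * Real.pi * Complex.I) * y‖ = 2 * Real.pi * ‖y‖ := by
    simp [abs_of_pos Real.pi_pos]
  have hmem : -(2 * Real.pi * Complex.I) * y ∈ rightSector ε := by
    have h : ε * ‖y‖ ≤ y.im := hy.2
    change ε * ‖-(2 * Real.pi * Complex.I) * y‖ ≤ (-(2 * Real.pi * Complex.I) * y).re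
    have hre : (-(2 * Real.pi * Complex.I) * y).re = 2 * Real.pi * y.im := by simp
    rw [hnorm, hre]
    nlinarith [Real.pi_pos]
  have h0 : -(2 * Real.pi * Complex.I) * y ≠ 0 :=
    mul_ne_zero (neg_ne_zero.mpr Complex.two_pi_I_ne_zero) (ne_zero_of_mem_upperSector hy)
  have h := hM _ hmem h0 hy1.le
  simp only [asymptoticSeries_coeff]
  rw [sum_Ico_neg_one_asymptoticCoeff, weightedSum_eq_tsum χ hy.1, ← sub_sub]
  refine h.trans (le_of_eq ?_)
  rw [hnorm, norm_pow]
  ring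

lemma asymptoticSeries_coeff_add_one (hN : 2 ≤ N) (χ : DirichletCharacter ℂ N) (n : ℕ) :
    (asymptoticSeries χ).coeff (n + 1) =
      -((bernoulli (n + 2) : ℂ) / ((n + 2).factorial : ℂ)) *
        iteratedDeriv n (weightedLogDeriv χ) 0 * (-(2 * Real.pi * Complex.I)) ^ (n + 1) := by
  rw [asymptoticSeries_coeff, show ((n : ℤ) + 1) = ((n + 1 : ℕ) : ℤ) by push_cast; rfl,
    asymptoticCoeff_natCast, iteratedDeriv_succ_weightedLog hN, eulerMaclaurinCoeff]

/-- Euler's evaluation of `ζ(2k+2)`, arranged to convert Euler–Maclaurin coefficients into Borel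
coefficients. -/
lemma bernoulli_div_factorial_mul_eq_riemannZeta {k : ℕ} :
    -((bernoulli (2 * k + 2) : ℂ) / ((2 * k + 2).factorial : ℂ)) *
      (-(2 * Real.pi * Complex.I)) ^ (2 * k + 1) =
        Complex.I / Real.pi * riemannZeta (2 * k + 2 : ℕ) := by
  have h := riemannZeta_two_mul_nat (k := k + 1) k.succ_ne_zero
  have hpi : (Real.pi : ℂ) ≠ 0 := by exact_mod_cast Real.pi_ne_zero
  have hI : (Complex.I : ℂ) ^ (2 * k) = (-1) ^ k := by rw [pow_mul, Complex.I_sq]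
  rw [show ((2 * k + 2 : ℕ) : ℂ) = 2 * ((k + 1 : ℕ) : ℂ) by push_cast; ring, h,
    show 2 * (k + 1) = 2 * k + 2 by ring, show 2 * k + 2 - 1 = 2 * k + 1 by omega,
    Odd.neg_pow ⟨k, rfl⟩, mul_pow, mul_pow, pow_succ Complex.I, hI]
  field_simp
  ring

lemma isBorelTransformNearZero_borelSum (hN : 2 ≤ N) {χ : DirichletCharacter ℂ N} (hχ : χ ≠ 1)
    (hodd : χ.Odd) : IsBorelTransformNearZero (asymptoticSeries χ) (borelSum χ) := by
  filter_upwards [eventually_hasSum_borelSum hN χ] with ξ hξ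
  refine hξ.of_forall_eq fun n => ?_
  rw [asymptoticSeries_coeff_add_one hN]
  rcases Nat.even_or_odd' n with ⟨k, rfl | rfl⟩
  · linear_combination iteratedDeriv (2 * k) (weightedLogDeriv χ) 0 * ξ ^ (2 * k) /
      ((2 * k).factorial : ℂ) * bernoulli_div_factorial_mul_eq_riemannZeta (k := k)
  · rw [iteratedDeriv_weightedLogDeriv_eq_zero_of_odd hN hχ hodd ⟨k, rfl⟩]
    simp

/-- For even `n` the derivative of the odd function `D` vanishes at `0`; for odd `n` the number
`B_{n+2}` vanishes. -/
lemma asymptoticSeries_coeff_add_one_eq_zero (hN : 2 ≤ N) {χ : DirichletCharacter ℂ N}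
    (hχ : χ ≠ 1) (heven : χ.Even) (n : ℕ) : (asymptoticSeries χ).coeff (n + 1) = 0 := by
  rw [asymptoticSeries_coeff_add_one hN]
  rcases Nat.even_or_odd n with hn | hn
  · rw [iteratedDeriv_weightedLogDeriv_eq_zero_of_even hN hχ heven hn]
    simp
  · rw [bernoulli_eq_zero_of_odd (hn.add_even even_two) (by omega)]
    simp

lemma hasSimplePoleTower_asymptoticSeries (hN : 2 ≤ N) {χ : DirichletCharacter ℂ N} (hχ : χ ≠ 1)
    (hodd : χ.Odd) :
    HasSimplePoleTower (asymptoticSeries χ) (2 * Real.pi * Complex.I / N) (stokesConstant χ) where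
  location_ne_zero := two_pi_I_div_ne_zero
  stokes_ne_zero _ hm := stokesConstant_ne_zero χ hm
  continuation := by
    refine ⟨borelSum χ, isBorelTransformNearZero_borelSum hN hχ hodd,
      fun ζ hζ => analyticAt_borelSum hN χ hζ, fun m hm => ?_⟩
    obtain ⟨h, hh, hB⟩ := hasSimplePoleAt_borelSum hN hodd hm
    refine ⟨h, hh, ?_⟩
    filter_upwards [hB, self_mem_nhdsWithin] with ζ hζ hne
    have hne' : ζ - m * (2 * Real.pi * Complex.I / N) ≠ 0 := sub_ne_zero.mpr hne
    have hpi : (Real.pi : ℂ) ≠ 0 := by exact_mod_cast Real.pi_ne_zero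
    rw [hζ]
    congr 1
    generalize ζ - m * (2 * Real.pi * Complex.I / N) = z at hne'
    field_simp
    rw [Complex.I_sq]
    ring

/-- A series whose part of positive degree vanishes has no Borel singularities. -/
lemma not_hasSimplePoleTower_of_coeff_eq_zero {φ : LaurentSeries ℂ}
    (hφ : ∀ n : ℕ, φ.coeff (n + 1) = 0) (A : ℂ) (S : ℤ → ℂ) : ¬ HasSimplePoleTower φ A S := by
  rintro ⟨hA, hS, B, hB, han, hpole⟩
  set P : Set ℂ := Set.range fun m : {m : ℤ // m ≠ 0} => ((m : ℤ) : ℂ) * A with hP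
  have hPc : P.Countable := Set.countable_range _
  -- The complement of a countable set in the plane is connected, so a continuation that is zero
  -- near `0` is zero off the singular points.
  have hconn : IsPreconnected Pᶜ :=
    (hPc.isPathConnected_compl_of_one_lt_rank
      (by rw [Complex.rank_real_complex]; norm_num)).isConnected.isPreconnected
  have hanP : AnalyticOnNhd ℂ B Pᶜ := fun ζ hζ => han ζ fun m hm h => hζ ⟨⟨m, hm⟩, h.symm⟩
  have h0 : (0 : ℂ) ∈ Pᶜ := by
    rintro ⟨⟨m, hm⟩, h⟩
    exact mul_ne_zero (by exact_mod_cast hm) hA h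
  have hB0 : B =ᶠ[𝓝 0] 0 := by
    filter_upwards [hB] with ζ hζ
    simp only [hφ, zero_div, zero_mul] at hζ
    exact hζ.unique hasSum_zero
  have hzero := hanP.eqOn_zero_of_preconnected_of_eventuallyEq_zero hconn h0 hB0
  obtain ⟨h, hh, hev⟩ := hpole 1 one_ne_zero
  rw [Int.cast_one, one_mul] at hh hev
  -- Distinct points `m A` are at least `|A|` apart, so the punctured disc of radius `|A|` about `A`
  -- avoids them all.
  have hmem : ∀ᶠ ζ in 𝓝[≠] A, ζ ∈ Pᶜ := by
    have hball : Metric.ball A ‖A‖ ∈ 𝓝 A := Metric.ball_mem_nhds A (norm_pos_iff.mpr hA)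
    filter_upwards [self_mem_nhdsWithin, nhdsWithin_le_nhds hball] with ζ hne hζ
    rintro ⟨⟨m, hm⟩, rfl⟩
    dsimp only at hne hζ
    rw [mem_ball_iff_norm, show (m : ℂ) * A - A = ((m - 1 : ℤ) : ℂ) * A by push_cast; ring,
      norm_mul, mul_lt_iff_lt_one_left (norm_pos_iff.mpr hA), Complex.norm_intCast] at hζ
    have hm1 : m - 1 = 0 := Int.abs_lt_one_iff.mp (by exact_mod_cast hζ)
    obtain rfl : m = 1 := by omega
    exact hne (by simp)
  -- With `B = 0` the regular part must cancel the polar part, so this product is constantly `S 1`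
  -- near `A`, yet it tends to `0`.
  have hlim : Tendsto (fun ζ => (ζ - A) * h ζ * (2 * Real.pi * Complex.I)) (𝓝[≠] A) (𝓝 0) := by
    have hc : ContinuousAt (fun ζ => (ζ - A) * h ζ * (2 * Real.pi * Complex.I)) A :=
      ((continuousAt_id.sub continuousAt_const).mul hh.continuousAt).mul continuousAt_const
    have := hc.tendsto.mono_left (nhdsWithin_le_nhds (s := {A}ᶜ))
    simpa using this
  have hconst : ∀ᶠ ζ in 𝓝[≠] A, (ζ - A) * h ζ * (2 * Real.pi * Complex.I) = S 1 := by
    filter_upwards [hmem, hev, self_mem_nhdsWithin] with ζ hζ hBζ hne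
    have hne' : ζ - A ≠ 0 := sub_ne_zero.mpr hne
    have hpi := Complex.two_pi_I_ne_zero
    have hz : B ζ = 0 := hzero hζ
    rw [hz] at hBζ
    have : h ζ = S 1 / (2 * Real.pi * Complex.I * (ζ - A)) := by linear_combination -hBζ
    rw [this]
    field_simp
  have hS1 := tendsto_nhds_unique (hlim.congr' hconst) tendsto_const_nhds
  exact hS 1 one_ne_zero hS1.symm

lemma isModularResurgentWith_asymptoticSeries (hN : 2 ≤ N) {χ : DirichletCharacter ℂ N}
    (hχ : χ ≠ 1) (hodd : χ.Odd) :
    IsModularResurgentWith (asymptoticSeries χ) (2 * Real.pi * Complex.I / N)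
      (stokesConstant χ) where
  gevrey := (isBorelTransformNearZero_borelSum hN hχ hodd).isGevreyOne
  tower := hasSimplePoleTower_asymptoticSeries hN hχ hodd
  lfunction_pos := definesLFunction_stokesConstant hχ
  -- The Stokes constants are odd in `m`, so `L_-` coincides with `L_+`.
  lfunction_neg := by
    simpa only [stokesConstant_neg, neg_neg] using definesLFunction_stokesConstant hχ

end

theorem theorem1p2 (N : ℕ) [NeZero N] (hN : 2 ≤ N) (χ : DirichletCharacter ℂ N)
    (hχ : χ.IsPrimitive) :
    -- the asymptotic expansion exists and is unique
    (∃! φ : LaurentSeries ℂ, HasAsymptoticExpansion (weightedSum χ) φ) ∧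
    ∀ φ : LaurentSeries ℂ, HasAsymptoticExpansion (weightedSum χ) φ →
      (IsModularResurgent φ ↔ χ.Odd) ∧
      (χ.Odd →
        -- simple poles at `2πim/N` with Stokes constants `R_m`
        IsModularResurgentWith φ (2 * Real.pi * Complex.I / N) (stokesConstant χ) ∧
        -- `∑_{m > 0} R_m m^{-s} = 2 L(s, χ) ζ(s + 1)`
        (∀ s : ℂ, 1 < s.re →
          LSeriesHasSum (fun m : ℕ => stokesConstant χ m) s
            (2 * (DirichletCharacter.LFunction χ s * riemannZeta (s + 1)))) ∧
        -- `Λ(s + 1, χ⁻¹) Λ_ζ(s) = (i √N / G(χ)) Λ(-s, χ) Λ_ζ(1 - s)` away from the poles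
        (∀ s : ℂ, s ≠ 0 → s ≠ 1 →
          completedDirichletL χ⁻¹ (s + 1) * completedRiemannZeta s =
            Complex.I * (Real.sqrt N : ℂ) / gaussSum χ ZMod.stdAddChar *
              (completedDirichletL χ (-s) * completedRiemannZeta (-s + 1)))) := by
  have hχ1 : χ ≠ 1 := ne_one_of_isPrimitive hN hχ
  have hexp := hasAsymptoticExpansion_weightedSum hN χ
  refine ⟨⟨_, hexp, fun ψ hψ => hψ.unique hexp⟩, fun φ hφ => ?_⟩
  obtain rfl := hφ.unique hexp
  refine ⟨⟨fun ⟨A, S, h⟩ => ?_, fun hodd =>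
      ⟨_, _, isModularResurgentWith_asymptoticSeries hN hχ1 hodd⟩⟩,
    fun hodd => ⟨isModularResurgentWith_asymptoticSeries hN hχ1 hodd,
      fun s hs => lseriesHasSum_stokesConstant χ hs,
      fun s _ _ => completedDirichletL_functional_equation hχ hodd s⟩⟩
  refine χ.even_or_odd.resolve_left fun heven => ?_
  exact not_hasSimplePoleTower_of_coeff_eq_zero
    (asymptoticSeries_coeff_add_one_eq_zero hN hχ1 heven) A S h.tower
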